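/- **Trees and grammars.** Trees are finite, rooted and ordered. A *tree adjoining grammar* (TAG) $G=\langle\Sigma,NT,I,A,S\rangle$ consists of finite sets $\Sigma$ of terminals and $NT$ of non-terminals, finite sets $I$ of initial and $A$ of auxiliary elementary trees, and a start symbol $S\in NT$. Non-frontier nodes are labelled by non-terminals, frontier nodes by a terminal, by the empty string $\varepsilon$, or by a non-terminal. A tree in $A$ has exactly one frontier node designated as its *foot*, labelled by the same non-terminal as its root; a tree in $I$ has none. All other frontier nodes labelled by a non-terminal are *marked for substitution*. There are no adjoining constraints. **Derivation.** From the elementary trees, trees are derived by repeated *substitution* (a node marked for substitution and labelled $X$ is replaced by a derived initial tree with root label $X$) and *adjunction* (a derived auxiliary tree with root and foot label $X$ is inserted at a node labelled $X$ of a derived tree: the subtree at that node is excised, the auxiliary tree is put in its place, and the excised subtree is put at the foot). $T(G)$ is the set of derivable trees with root label $S$ in which every frontier node is labelled by a terminal or $\varepsilon$; $L(G)\subseteq\Sigma^*$ is the set of their yields. **Regular adjunction.** The *spine* of an auxiliary tree is the path from root to foot, both included. The tree is *proper* if no node of the spine other than root and foot has the label of the root. Adjunction of an auxiliary tree $\gamma_1$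 at a node $\eta$ of a tree $\gamma$ is *regular* if both of the following hold. 1. One of these cases applies: (a) $\gamma$ is an initial tree, or $\gamma$ is an auxiliary tree and $\eta$ is not on its spine; (b) $\gamma$ is an auxiliary tree, $\eta$ is its root or its foot, and $\gamma_1$ is proper; (c) $\gamma$ is an auxiliary tree, $\eta$ is on its spine, and $\gamma$ cannot be adjoined at any node on the spine of $\gamma_1$, i.e. the root label of $\gamma$ does not occur on the spine of $\gamma_1$. 2. For every auxiliary tree $\gamma_2$ that was adjoined earlier in the derivation of $\gamma$ and has $\eta$ on its spine strictly between its root and its foot, the root label of $\gamma_2$ does not occur on the spine of $\gamma_1$. (Here the spine of an adjoined tree grows with later adjunctions at nodes strictly between its root and its foot.) $T_R(G)$ is the set of trees defined like $T(G)$, with all adjunctions in the derivation, including those in the derivations of the inserted trees, required to be regular. **Proposition.** Let $G$ be a TAG with $T(G)=T_R(G)$. Then there are a Turing machine with finitely many stacks (equivalently, a multitape Turing machine) and a constant $c$ such that the machine decides, for every string $w\in\Sigma^*$, whether $w\in L(G)$, and it halts after at most $c\,n^3$ steps whenever $w$ has length $n\ge 1$. -/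

import Mathlib

/-- Finite, ordered, labelled trees over terminals `T`.
`leaf (some a)` is a frontier node labelled with the terminal `a`, and `leaf none` is a frontier
node labelled with the empty string. `foot v` is a foot node. `node v ts` is a non-terminal node
with the children `ts`; the node `node v []`, which lies on the frontier, is a node
marked for substitution. The node label `v : V` is a non-terminal, possibly with extra data. -/
inductive TagTree (V : Type) (T : Type) : Type
  | leaf : Option T → TagTree V T
  | foot : V → TagTree V T
  | node : V → List (TagTree V T) → TagTree V T

/-- Trees with one position (the hole) singled out. -/
inductive TagCtx (V : Type) (T : Type) : Type
  | hole : TagCtx V T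
  | node : V → List (TagTree V T) → TagCtx V T → List (TagTree V T) → TagCtx V T

namespace TagTree

variable {V W T : Type}

/-- The label of the root, if it is not a terminal or the empty string. -/
def rootLabel : TagTree V T → Option V
  | leaf _ => none
  | foot v => some v
  | node v _ => some v

/-- Apply a function to all non-terminal labels. -/
def map (f : V → W) : TagTree V T → TagTree W T
  | leaf a => leaf a
  | foot v => foot (f v)
  | node v ts => node (f v) (ts.map (map f))

/-- The string of terminals on the frontier, read from left to right. -/
def yield : TagTree V T → List T
  | leaf a => a.toList
  | foot _ => []
  | node _ ts => (ts.map yield).flatten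

/-- The tree has no foot node. -/
inductive FootFree : TagTree V T → Prop
  | leaf (a : Option T) : FootFree (leaf a)
  | node (v : V) (ts : List (TagTree V T)) (h : ∀ t ∈ ts, FootFree t) : FootFree (node v ts)

/-- Every frontier node is labelled with a terminal (or the empty string): there is neither a foot
nor a node marked for substitution. -/
inductive Completed : TagTree V T → Prop
  | leaf (a : Option T) : Completed (leaf a)
  | node (v : V) (ts : List (TagTree V T)) (hne : ts ≠ []) (h : ∀ t ∈ ts, Completed t) :
      Completed (node v ts)

end TagTree

namespace TagCtx

variable {V T : Type}

/-- Put a tree into the hole. -/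
def fill : TagCtx V T → TagTree V T → TagTree V T
  | hole, s => s
  | node v l c r, s => TagTree.node v (l ++ c.fill s :: r)

/-- The labels on the path from the root to the hole, top down, the hole excluded. -/
def path : TagCtx V T → List V
  | hole => []
  | node v _ c _ => v :: c.path

/-- No tree hanging off the path from the root to the hole has a foot node. -/
def FootFree : TagCtx V T → Prop
  | hole => True
  | node _ l c r => (∀ t ∈ l, t.FootFree) ∧ c.FootFree ∧ ∀ t ∈ r, t.FootFree

/-- Change the labels on the path from the root to the hole. -/
def mapPath (f : V → V) : TagCtx V T → TagCtx V T
  | hole => hole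
  | node v l c r => node (f v) l (c.mapPath f) r

end TagCtx

/-- A tree adjoining grammar with non-terminals `N` and terminals `T`, both supposed to be finite.
The initial trees have no foot; an auxiliary tree has exactly one foot, and the root has the same
label as the foot. -/
structure TreeAdjoiningGrammar (N : Type) (T : Type) where
  initial : Finset (TagTree N T)
  auxiliary : Finset (TagTree N T)
  start : N
  initial_footFree : ∀ t ∈ initial, t.FootFree
  auxiliary_foot : ∀ t ∈ auxiliary, ∃ (X : N) (D : TagCtx N T),
    D.FootFree ∧ t = D.fill (TagTree.foot X) ∧ t.rootLabel = some X

namespace TreeAdjoiningGrammar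

variable {N T : Type}

/-- All initial and auxiliary trees derivable in `G`.
`C.fill s` is a tree with a distinguished node, the root of `s`.
In a substitution this is a node marked for substitution, which is replaced by an initial tree.
In an adjunction, the auxiliary tree is `D.fill (foot X)`; it is inserted at the distinguished
node, and the excised subtree `s` takes the place of its foot. -/
inductive Derivable (G : TreeAdjoiningGrammar N T) : TagTree N T → Prop
  | initial (t : TagTree N T) (h : t ∈ G.initial) : Derivable G t
  | auxiliary (t : TagTree N T) (h : t ∈ G.auxiliary) : Derivable G t
  | substitution (C : TagCtx N T) (X : N) (t : TagTree N T)
      (hhost : Derivable G (C.fill (TagTree.node X []))) (ht : Derivable G t)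
      (hinit : t.FootFree) (hroot : t.rootLabel = some X) :
      Derivable G (C.fill t)
  | adjunction (C D : TagCtx N T) (s : TagTree N T) (X : N)
      (hhost : Derivable G (C.fill s)) (haux : Derivable G (D.fill (TagTree.foot X)))
      (hlabel : s.rootLabel = some X) :
      Derivable G (C.fill (D.fill s))

/-- `T(G)`: the completed initial trees derivable in `G` with root labelled by the start symbol. -/
def completedTrees (G : TreeAdjoiningGrammar N T) : Set (TagTree N T) :=
  {t | G.Derivable t ∧ t.Completed ∧ t.rootLabel = some G.start}

/-- `L(G)`: the yields of the trees in `T(G)`. -/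
def language (G : TreeAdjoiningGrammar N T) : Language T :=
  {w | ∃ t ∈ G.completedTrees, t.yield = w}

/-! ### Regular adjunction

An adjoined auxiliary tree keeps its spine inside the derived tree. So that this can be taken into
account in later adjunctions, a node carries, besides its non-terminal, the set of the root labels
of all auxiliary trees adjoined so far on whose spine it lies strictly between root and foot. -/

/-- A node label in a regular derivation: the non-terminal `sym`, and the set `inner` of the root
labels of those auxiliary trees, adjoined so far, that have the node on their spine, but neither as
their root nor as their foot. -/
structure SpineLabel (N : Type) where
  sym : N
  inner : Set N

/-- An elementary tree: no auxiliary tree has been adjoined. -/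
def unmarked (t : TagTree N T) : TagTree (SpineLabel N) T := t.map fun X => ⟨X, ∅⟩

/-- Forget the records. -/
def erase (t : TagTree (SpineLabel N) T) : TagTree N T := t.map SpineLabel.sym

/-- The non-terminals on the spine of the auxiliary tree `D.fill (foot v)`, root and foot
included. -/
def spineLabels (D : TagCtx (SpineLabel N) T) (v : SpineLabel N) : List N :=
  D.path.map SpineLabel.sym ++ [v.sym]

/-- The auxiliary tree `D.fill (foot v)` is proper: no node on its spine other than the root and the
foot has the label of the root (which is the label of the foot). -/
def Proper (D : TagCtx (SpineLabel N) T) (v : SpineLabel N) : Prop :=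
  v.sym ∉ D.path.tail.map SpineLabel.sym

/-- The effect on the records of adjoining an auxiliary tree `D.fill (foot v)` with root label
`X` at a node with record `K`: every node on its spine now lies inside all spines that the node
was inside of, and its nodes strictly between root and foot moreover lie inside its own spine.
(The foot merges with the node of adjunction and has the record of that node.) -/
def markSpine (X : N) (K : Set N) : TagCtx (SpineLabel N) T → TagCtx (SpineLabel N) T
  | .hole => .hole
  | .node v l c r =>
      .node ⟨v.sym, v.inner ∪ K⟩ l (c.mapPath fun u => ⟨u.sym, insert X (u.inner ∪ K)⟩) r

/-- Adjoining the auxiliary tree `D.fill (foot v)` to `C.fill s` at the root of `s`, which is a node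
labelled `u`, is regular.

`host`: if `C.fill s` is an auxiliary tree with the node on its spine (that is, its foot, labelled
`x`, is in `s`), then either the node is the root or the foot of this tree and the adjoined tree
is proper, or this tree cannot be adjoined at any node on the spine of the adjoined tree. In all
other cases (the tree is initial, or the node is not on its spine) there is no such restriction.

`inside`: for every previously adjoined auxiliary tree with the node on its spine
strictly between root and foot, that tree cannot be adjoined at any node on the spine of the
adjoined tree. -/
structure RegularAt (C : TagCtx (SpineLabel N) T) (s : TagTree (SpineLabel N) T)
    (u : SpineLabel N) (D : TagCtx (SpineLabel N) T) (v : SpineLabel N) : Prop where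
  host : ∀ (F : TagCtx (SpineLabel N) T) (x : SpineLabel N), s = F.fill (TagTree.foot x) →
    ((C = TagCtx.hole ∨ F = TagCtx.hole) ∧ Proper D v) ∨ x.sym ∉ spineLabels D v
  inside : ∀ Z ∈ u.inner, Z ∉ spineLabels D v

/-- All initial and auxiliary trees, with records, that are derivable in `G` by
substitution and regular adjunction. -/
inductive RegularDerivable (G : TreeAdjoiningGrammar N T) : TagTree (SpineLabel N) T → Prop
  | initial (t : TagTree N T) (h : t ∈ G.initial) : RegularDerivable G (unmarked t)
  | auxiliary (t : TagTree N T) (h : t ∈ G.auxiliary) : RegularDerivable G (unmarked t)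
  | substitution (C : TagCtx (SpineLabel N) T) (u v : SpineLabel N)
      (t : TagTree (SpineLabel N) T)
      (hhost : RegularDerivable G (C.fill (TagTree.node u []))) (ht : RegularDerivable G t)
      (hinit : t.FootFree) (hroot : t.rootLabel = some v) (hsym : v.sym = u.sym) :
      RegularDerivable G (C.fill t)
  | adjunction (C D : TagCtx (SpineLabel N) T) (s : TagTree (SpineLabel N) T)
      (u v : SpineLabel N)
      (hhost : RegularDerivable G (C.fill s))
      (haux : RegularDerivable G (D.fill (TagTree.foot v)))
      (hlabel : s.rootLabel = some u) (hsym : v.sym = u.sym) (hreg : RegularAt C s u D v) :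
      RegularDerivable G (C.fill ((markSpine v.sym u.inner D).fill s))

/-- `T_R(G)`: the completed initial trees derivable in `G` by regular adjunction, with root labelled
by the start symbol. -/
def regularTrees (G : TreeAdjoiningGrammar N T) : Set (TagTree N T) :=
  {t | (∃ γ, G.RegularDerivable γ ∧ erase γ = t) ∧ t.Completed ∧ t.rootLabel = some G.start}

end TreeAdjoiningGrammar

/-- Membership in `L` is decided by a Turing machine with finitely many stacks (equivalently, tapes)
that halts on every input of length `n ≥ 1` with the correct answer after at most `c * n ^ 3`
steps, for a constant `c`. -/
def RecognizableInCubicTime {T : Type} (L : Language T) : Prop :=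
  ∃ (f : List T → Bool) (M : Turing.TM2ComputableInTime id Computability.encodeBool f) (c : ℕ),
    (∀ w, f w = true ↔ w ∈ L) ∧ ∀ n, 1 ≤ n → M.time n ≤ c * n ^ 3

/-! Regular derivations can be rearranged into a top-down process controlled by a finite
context-free grammar, and context-free languages are recognized in cubic time by chart parsing.

The non-terminals of the grammar `regularGrammar` are pieces of trees, with records, that remain to
be processed. At the root of a tree `s` at most one elementary auxiliary tree is adjoined, and its
spine must avoid the record of that root. The new root is then closed to adjunction, while `s`, now
at the foot, keeps its record and may be processed again; several adjunctions at one node are thus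
replayed at successive feet. Afterwards the children are processed independently of each other.

Finitely many pieces suffice. A root label `X` lies on its own spine, so `X` can be adjoined only at
a node whose record `K` does not contain it, and the nodes strictly inside the new spine get records
containing `K ∪ {X}`. Hence a tree waiting at a node with record `K` has height at most `d * (1 +
|K|)`, where `d` bounds the elementary trees, and `|K|` is at most the number of non-terminals
(`isClosed_boundedItems`).

The grammar covers all regular derivations, although these may adjoin derived auxiliary trees in any
order (`RegularDerivable.covered`). The invariant for a derived auxiliary tree, `AdjunctionSound`,
says that whatever can be generated after adjoining it can already be generated before. It survives
an adjunction on the spine by `AdjunctionSound.adjoin`, which is where the regularity conditions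
enter: the outer tree can be adjoined first, and the inner one is still admissible afterwards.
Conversely, a grammar derivation adjoins elementary trees to foot-free trees, where regularity
reduces to the condition on records (`Generates.completable`).

Together these give `generates_startItem_iff`; the cubic bound comes from
`BinaryGrammar.recognizableInCubicTime`, and the hypothesis on `G` transfers it to the language of
`G`. -/

/-! ### A stack machine for chart parsing. -/

/-- The finite data by which a chart parser computes the value of a string of length at least two
from the values of its proper prefixes and suffixes. -/
structure ChartAlgebra (T P : Type) where
  empty : P
  zero : P
  letter : T → P
  add : P → P → P → P
  close : P → P
  accept : P → Bool

namespace ChartAlgebra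

variable {T P : Type}

/-- The contents of the chart machine. -/
inductive Stack : Type
  | input | output | table | passed | column | buffer
  deriving DecidableEq

instance : Fintype Stack :=
  ⟨{.input, .output, .table, .passed, .column, .buffer}, fun k => by cases k <;> decide⟩

/-- The labels of the chart machine. -/
inductive Label : Type
  | read | zip | rewind | restore | finish
  deriving DecidableEq

instance : Fintype Label :=
  ⟨{.read, .zip, .rewind, .restore, .finish}, fun l => by cases l <;> decide⟩

/-- The stack alphabets of the chart machine; `none` on the table separates rows. -/
def Alphabet (T P : Type) : Stack → Type
  | .input => T
  | .output => Bool
  | .table => Option P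
  | .passed => Option P
  | .column => P
  | .buffer => P

/-- The internal state of the chart machine: an accumulator and registers for popped symbols. -/
structure Register (T P : Type) : Type where
  acc : P
  item : Option (Option P)
  cell : Option P
  letter : Option T

/-- The registers without any popped symbols. -/
def Register.clean (p : P) : Register T P := ⟨p, none, none, none⟩

theorem Register.finite [Finite T] [Finite P] : Finite (Register T P) := by
  refine Finite.of_injective
    (fun r : Register T P => (r.acc, r.item, r.cell, r.letter)) ?_
  rintro ⟨a, b, c, d⟩ ⟨a', b', c', d'⟩ h
  simp only [Prod.mk.injEq] at h
  obtain ⟨rfl, rfl, rfl, rfl⟩ := h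
  rfl

open Turing.TM2.Stmt in
/-- The program of the chart machine. -/
def program (A : ChartAlgebra T P) :
    Label → Turing.TM2.Stmt (Alphabet T P) Label (Register T P)
  | .read =>
      pop .input (fun v x => { v with letter := x }) <|
      branch (fun v => v.letter.isSome)
        (push .table (fun _ => (none : Option P)) <|
          load (fun v => .clean (v.letter.elim A.zero A.letter)) <| goto fun _ => .zip)
        (goto fun _ => .finish)
  | .zip =>
      pop .table (fun v x => { v with item := x }) <|
      -- The popped item has two layers: an outer `none` signals an empty stack, an inner `none` the
      -- separator of rows.
      branch (fun v => v.item.isNone) (goto fun _ => .restore) <|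
      push .passed (fun v => v.item.join) <|
      branch (fun v => v.item.join.isNone)
        (load (fun v => .clean v.acc) <| goto fun _ => .rewind) <|
      pop .column (fun v x => { v with cell := x }) <|
      push .buffer (fun v => v.cell.getD A.zero) <|
      load (fun v => .clean (A.add v.acc (v.item.join.getD A.zero) (v.cell.getD A.zero))) <|
      goto fun _ => .zip
  | .rewind =>
      pop .buffer (fun v x => { v with cell := x }) <|
      branch (fun v => v.cell.isSome)
        (push .column (fun v => v.cell.getD A.zero) <|
          load (fun v => .clean v.acc) <| goto fun _ => .rewind)
        (push .column (fun v => A.close v.acc) <|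
          load (fun _ => .clean A.zero) <| goto fun _ => .zip)
  | .restore =>
      pop .passed (fun v x => { v with item := x }) <|
      branch (fun v => v.item.isNone) (goto fun _ => .read) <|
      push .table (fun v => v.item.join) <|
      branch (fun v => v.item.join.isNone)
        (pop .column (fun v x => { v with cell := x }) <|
          push .table (fun v => v.cell) <|
          load (fun v => .clean v.acc) <| goto fun _ => .restore)
        (load (fun v => .clean v.acc) <| goto fun _ => .restore)
  | .finish =>
      pop .table (fun v x => { v with item := x }) <|
      branch (fun v => v.item.isNone)
        -- The register returns to its initial value because the halting configuration is prescribed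
        -- completely.
        (push .output (fun v => A.accept v.acc) <| load (fun _ => .clean A.empty) halt)
        (load (fun v => .clean (v.item.join.getD v.acc)) <| goto fun _ => .finish)

/-- The words on all the contents. -/
def contents (inp : List T) (out : List Bool) (tab pas : List (Option P)) (col buf : List P) :
    ∀ k, List (Alphabet T P k)
  | .input => inp
  | .output => out
  | .table => tab
  | .passed => pas
  | .column => col
  | .buffer => buf

/-- A configuration of the chart machine with clean registers. -/
def config (l : Option Label) (p : P) (inp : List T) (out : List Bool)
    (tab pas : List (Option P)) (col buf : List P) :
    Turing.TM2.Cfg (Alphabet T P) Label (Register T P) :=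
  ⟨l, .clean p, contents inp out tab pas col buf⟩

/-- Updated stack families and `contents` are compared one stack at a time; after this reduction
every instruction is verified by computation. -/
theorem step_eq_config (A : ChartAlgebra T P) {l : Label} {p q : P} {l' : Option Label}
    {inp inp' : List T} {out out' : List Bool} {tab tab' pas pas' : List (Option P)}
    {col col' buf buf' : List P}
    (hl : (Turing.TM2.stepAux (A.program l) (.clean p)
      (contents inp out tab pas col buf)).l = l')
    (hv : (Turing.TM2.stepAux (A.program l) (.clean p)
      (contents inp out tab pas col buf)).var = .clean q)
    (hs : ∀ k, (Turing.TM2.stepAux (A.program l) (.clean p)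
      (contents inp out tab pas col buf)).stk k = contents inp' out' tab' pas' col' buf' k) :
    Turing.TM2.step A.program (config (some l) p inp out tab pas col buf) =
      some (config l' q inp' out' tab' pas' col' buf') := by
  unfold config
  rw [Turing.TM2.step]
  generalize Turing.TM2.stepAux (A.program l) (.clean p)
      (contents inp out tab pas col buf) = c at hl hv hs
  cases c
  congr 2
  exact funext hs

section Steps

variable (A : ChartAlgebra T P) (p : P) (inp : List T) (out : List Bool)
  (tab pas : List (Option P)) (col buf : List P)

theorem step_read_cons (a : T) :
    Turing.TM2.step A.program
      (config (some .read) p (a :: inp) out tab pas col buf) =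
    some (config (some .zip) (A.letter a) inp out (none :: tab) pas col buf) :=
  step_eq_config A rfl rfl fun k => by cases k <;> rfl

theorem step_read_nil :
    Turing.TM2.step A.program
      (config (some .read) p [] out tab pas col buf) =
    some (config (some .finish) p [] out tab pas col buf) :=
  step_eq_config A rfl rfl fun k => by cases k <;> rfl

theorem step_zip_some (x y : P) :
    Turing.TM2.step A.program
      (config (some .zip) p inp out (some x :: tab) pas (y :: col) buf) =
    some (config (some .zip) (A.add p x y) inp out tab (some x :: pas) col (y :: buf)) :=
  step_eq_config A rfl rfl fun k => by cases k <;> rfl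

theorem step_zip_none :
    Turing.TM2.step A.program
      (config (some .zip) p inp out (none :: tab) pas col buf) =
    some (config (some .rewind) p inp out tab (none :: pas) col buf) :=
  step_eq_config A rfl rfl fun k => by cases k <;> rfl

theorem step_zip_nil :
    Turing.TM2.step A.program
      (config (some .zip) p inp out [] pas col buf) =
    some (config (some .restore) p inp out [] pas col buf) :=
  step_eq_config A rfl rfl fun k => by cases k <;> rfl

theorem step_rewind_cons (y : P) :
    Turing.TM2.step A.program
      (config (some .rewind) p inp out tab pas col (y :: buf)) =
    some (config (some .rewind) p inp out tab pas (y :: col) buf) :=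
  step_eq_config A rfl rfl fun k => by cases k <;> rfl

theorem step_rewind_nil :
    Turing.TM2.step A.program
      (config (some .rewind) p inp out tab pas col []) =
    some (config (some .zip) A.zero inp out tab pas (A.close p :: col) []) :=
  step_eq_config A rfl rfl fun k => by cases k <;> rfl

theorem step_restore_some (x : P) :
    Turing.TM2.step A.program
      (config (some .restore) p inp out tab (some x :: pas) col buf) =
    some (config (some .restore) p inp out (some x :: tab) pas col buf) :=
  step_eq_config A rfl rfl fun k => by cases k <;> rfl

theorem step_restore_none (y : P) :
    Turing.TM2.step A.program
      (config (some .restore) p inp out tab (none :: pas) (y :: col) buf) =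
    some (config (some .restore) p inp out (some y :: none :: tab) pas col buf) :=
  step_eq_config A rfl rfl fun k => by cases k <;> rfl

theorem step_restore_nil :
    Turing.TM2.step A.program
      (config (some .restore) p inp out tab [] col buf) =
    some (config (some .read) p inp out tab [] col buf) :=
  step_eq_config A rfl rfl fun k => by cases k <;> rfl

theorem step_finish_cons (x : Option P) :
    Turing.TM2.step A.program
      (config (some .finish) p inp out (x :: tab) pas col buf) =
    some (config (some .finish) (x.getD p) inp out tab pas col buf) :=
  step_eq_config A rfl rfl fun k => by cases k <;> rfl

theorem step_finish_nil :
    Turing.TM2.step A.program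
      (config (some .finish) p inp out [] pas col buf) =
    some (config none A.empty inp (A.accept p :: out) [] pas col buf) :=
  step_eq_config A rfl rfl fun k => by cases k <;> rfl

end Steps
end ChartAlgebra

/-! ### Correctness and running time of the chart machine. -/

namespace ChartAlgebra

variable {T P : Type}

/-- The chart machine goes from one configuration to another in at most `n` steps. -/
def Runs (A : ChartAlgebra T P) (n : ℕ)
    (c c' : Turing.TM2.Cfg (Alphabet T P) Label (Register T P)) : Prop :=
  ∃ m ≤ n, (flip bind (Turing.TM2.step A.program))^[m] (some c) = some c'

variable {A : ChartAlgebra T P} {m n : ℕ}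
  {c c' c'' : Turing.TM2.Cfg (Alphabet T P) Label (Register T P)}

theorem Runs.refl : A.Runs 0 c c := ⟨0, le_rfl, rfl⟩

theorem Runs.of_step (h : Turing.TM2.step A.program c = some c') : A.Runs 1 c c' :=
  ⟨1, le_rfl, h⟩

theorem Runs.trans (h : A.Runs m c c') (h' : A.Runs n c' c'') : A.Runs (m + n) c c'' := by
  obtain ⟨k, hk, h⟩ := h
  obtain ⟨k', hk', h'⟩ := h'
  exact ⟨k' + k, by omega, by rw [Function.iterate_add_apply, h, h']⟩

theorem Runs.mono (h : A.Runs m c c') (hmn : m ≤ n) : A.Runs n c c' := by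
  obtain ⟨k, hk, h⟩ := h
  exact ⟨k, hk.trans hmn, h⟩

theorem Runs.head (h : Turing.TM2.step A.program c = some c') (h' : A.Runs n c' c'') :
    A.Runs (n + 1) c c'' :=
  ((Runs.of_step h).trans h').mono (by omega)

section Value

variable (A) (S : List T → P)

/-- The values of the nonempty prefixes of a string. -/
def row (s : List T) : List P :=
  (List.range s.length).map fun k => S (s.take (k + 1))

/-- The values of the strings `t ++ [a]`, for all suffixes `t` of a string. -/
def col (a : T) : List T → List P
  | [] => [S [a]]
  | x :: s => S (x :: s ++ [a]) :: col a s

/-- The chart for a string, as it is stored on the table: the rows belong to the nonempty suffixes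
of the string, the shortest one first. -/
def chart : List T → List (Option P)
  | [] => []
  | x :: s => chart s ++ ((row S (x :: s)).map some ++ [none])

/-- The chart for a string, and an empty row, after it has been moved from one stack to another. -/
def revChart : List T → List (Option P)
  | [] => [none]
  | x :: s => none :: (((row S (x :: s)).reverse).map some ++ revChart s)

theorem row_append (s : List T) (a : T) : row S (s ++ [a]) = row S s ++ [S (s ++ [a])] := by
  simp only [row, List.length_append, List.length_singleton, List.range_succ, List.map_append,
    List.map_cons, List.map_nil]
  congr 1
  · refine List.map_congr_left fun k hk => ?_
    rw [List.take_append_of_le_length (by simpa using hk)]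
  · rw [List.take_of_length_le (by simp)]

theorem length_row (s : List T) : (row S s).length = s.length := by simp [row]

theorem length_col (a : T) (s : List T) : (col S a s).length = s.length + 1 := by
  induction s with
  | nil => rfl
  | cons x s ih => simp [col, ih]

theorem col_eq (a : T) (s : List T) :
    col S a s = (List.range (s.length + 1)).map fun k => S (s.drop k ++ [a]) := by
  induction s with
  | nil => rfl
  | cons x s ih =>
    rw [col, ih, List.length_cons, List.range_succ_eq_map (n := s.length + 1)]
    simp [Function.comp_def]

/-- The values of all strings are obtained from those of the letters by means of a chart. -/
structure Computes : Prop where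
  nil : S [] = A.empty
  letter : ∀ a, S [a] = A.close (A.letter a)
  split : ∀ (x : T) (s : List T) (a : T), S (x :: s ++ [a]) =
    A.close (((row S (x :: s)).zip (col S a s)).foldl (fun p q => A.add p q.1 q.2) A.zero)

end Value

variable {S : List T → P} {p : P} {inp : List T} {out : List Bool}
  {tab pas : List (Option P)} {co buf : List P}

/-- One inner product of a table row with the column. Both lists are saved in reverse, the row for
`restore` and the column for `rewind`. -/
theorem runs_zip (xs ys : List P) (h : xs.length = ys.length) (p : P)
    (pas : List (Option P)) (buf : List P) :
    A.Runs xs.length (config (some .zip) p inp out (xs.map some ++ tab) pas (ys ++ co) buf)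
      (config (some .zip) ((xs.zip ys).foldl (fun p q => A.add p q.1 q.2) p) inp out tab
        (xs.reverse.map some ++ pas) co (ys.reverse ++ buf)) := by
  induction xs generalizing ys p pas buf with
  | nil =>
    obtain rfl : ys = [] := List.length_eq_zero_iff.1 h.symm
    exact .refl
  | cons x xs ih =>
    obtain _ | ⟨y, ys⟩ := ys
    · simp at h
    · refine Runs.head (step_zip_some ..) ?_
      simpa using ih ys (by simpa using h) (A.add p x y) (some x :: pas) (y :: buf)

theorem runs_rewind (co buf : List P) :
    A.Runs (buf.length + 1) (config (some .rewind) p inp out tab pas co buf)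
      (config (some .zip) A.zero inp out tab pas (A.close p :: (buf.reverse ++ co)) []) := by
  induction buf generalizing co with
  | nil => exact .of_step (step_rewind_nil ..)
  | cons y buf ih =>
    refine Runs.head (step_rewind_cons ..) ?_
    simpa using ih (y :: co)

/-- Rows list prefixes by increasing length, while the column lists suffixes by decreasing length,
so entries met simultaneously belong to the two halves of one split. Each row therefore yields the
value for the next longer suffix, which goes on top of the column. -/
theorem runs_pass (hS : A.Computes S) (a : T) (s : List T) (tab pas : List (Option P)) :
    A.Runs ((s.length + 1) * (s.length + 2))
      (config (some .zip) (A.letter a) inp out (none :: (chart S s ++ tab)) pas [] [])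
      (config (some .zip) A.zero inp out tab (revChart S s ++ pas) (col S a s) []) := by
  induction s generalizing tab with
  | nil =>
    simpa [chart, revChart, col, hS.letter] using
      Runs.head (step_zip_none A (A.letter a) inp out tab pas [] []) (runs_rewind [] [])
  | cons x s ih =>
    have h1 := ih ((row S (x :: s)).map some ++ none :: tab)
    have h2 := runs_zip (A := A) (inp := inp) (out := out) (tab := none :: tab) (co := [])
      (row S (x :: s)) (col S a s) (by rw [length_row, length_col]; rfl) A.zero
      (revChart S s ++ pas) []
    rw [List.append_nil] at h2
    have h3 := (h1.trans h2).trans (Runs.head (step_zip_none ..) (runs_rewind _ _))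
    simp only [length_row, List.length_cons, List.append_nil, List.length_reverse, length_col,
      List.reverse_reverse] at h3
    have hs := hS.split x s a
    simp only [List.cons_append] at hs
    simp only [chart, revChart, col, hs, List.append_assoc, List.cons_append,
      List.nil_append, List.length_cons]
    -- With `n = s.length`, the new row costs `n + 1` steps to zip, one for the separator and `n +
    -- 2` to rewind: `2 * n + 4`, exactly the increment of the bound.
    exact h3.mono (by nlinarith)

theorem runs_restore_row (xs : List P) (tab : List (Option P)) :
    A.Runs xs.length (config (some .restore) p inp out tab (xs.map some ++ pas) co buf)
      (config (some .restore) p inp out (xs.reverse.map some ++ tab) pas co buf) := by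
  induction xs generalizing tab with
  | nil => exact .refl
  | cons x xs ih =>
    refine Runs.head (step_restore_some ..) ?_
    simpa using ih (some x :: tab)

/-- Moving the rows back reverses them again, so a column entry pushed right after the separator
becomes the last entry of its row, as `row_append` requires. -/
theorem runs_restore (a : T) (s : List T) (tab : List (Option P)) :
    A.Runs ((s.length + 1) * (s.length + 1) + 1)
      (config (some .restore) p inp out tab (revChart S s) (col S a s) buf)
      (config (some .read) p inp out (chart S (s ++ [a]) ++ tab) [] [] buf) := by
  induction s generalizing tab with
  | nil =>
    simpa [chart, revChart, col, row] using
      Runs.head (step_restore_none A p inp out tab [] [] buf (S [a]))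
        (.of_step (step_restore_nil ..))
  | cons x s ih =>
    have h2 := runs_restore_row (A := A) (inp := inp) (out := out) (p := p) (buf := buf)
      (co := col S a s) (pas := revChart S s)
      ((row S (x :: s)).reverse) (some (S (x :: s ++ [a])) :: none :: tab)
    have h3 := (Runs.head (step_restore_none ..) h2).trans (ih _)
    have := row_append S (x :: s) a
    simp only [List.cons_append] at this
    simp only [length_row, List.length_cons, List.length_reverse, List.reverse_reverse,
      List.cons_append] at h3
    simp only [chart, revChart, col, List.append_assoc, List.cons_append, this, List.map_append,
      List.map_cons, List.map_nil, List.nil_append, List.length_cons]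
    exact h3.mono (by nlinarith)

theorem runs_letter (hS : A.Computes S) (a : T) (s : List T) :
    A.Runs (6 * (s.length + 1) ^ 2)
      (config (some .read) p (a :: inp) out (chart S s) [] [] [])
      (config (some .read) A.zero inp out (chart S (s ++ [a])) [] [] []) := by
  have h1 := runs_pass (inp := inp) (out := out) hS a s [] []
  rw [List.append_nil, List.append_nil] at h1
  have h2 := runs_restore (A := A) (inp := inp) (out := out) (S := S) (p := A.zero) (buf := [])
    a s []
  rw [List.append_nil] at h2
  exact (Runs.head (step_read_cons ..) (h1.trans (Runs.head (step_zip_nil ..) h2))).mono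
    (by nlinarith)

/-- The final accumulator is tracked only if nothing is read: for the empty input the answer comes
from the initial register, otherwise from the table. -/
theorem runs_read (hS : A.Computes S) (v s : List T) (p : P) :
    ∃ q, (v = [] → q = p) ∧ A.Runs (6 * (v.length * (s.length + v.length) ^ 2))
      (config (some .read) p v out (chart S s) [] [] [])
      (config (some .read) q [] out (chart S (s ++ v)) [] [] []) := by
  induction v generalizing s p with
  | nil => exact ⟨p, fun _ => rfl, by simpa using Runs.refl⟩
  | cons a v ih =>
    obtain ⟨q, -, hq⟩ := ih (s ++ [a]) A.zero
    refine ⟨q, fun h => by simp at h, ?_⟩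
    have h := (runs_letter (inp := v) (out := out) (p := p) hS a s).trans hq
    rw [List.append_assoc, List.singleton_append] at h
    refine h.mono ?_
    simp only [List.length_append, List.length_cons, List.length_nil, zero_add]
    have : (s.length + 1) ^ 2 ≤ (s.length + (v.length + 1)) ^ 2 :=
      Nat.pow_le_pow_left (by omega) 2
    rw [show s.length + 1 + v.length = s.length + (v.length + 1) by ring]
    nlinarith

theorem runs_finish (tab : List (Option P)) (p : P) :
    A.Runs (tab.length + 1) (config (some .finish) p [] [] tab [] [] [])
      (config none A.empty [] [A.accept (tab.foldl (fun q x => x.getD q) p)] [] [] [] []) := by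
  induction tab generalizing p with
  | nil => exact .of_step (step_finish_nil ..)
  | cons x tab ih => exact Runs.head (step_finish_cons ..) (ih _)

theorem length_chart (s : List T) : (chart S s).length ≤ 2 * s.length ^ 2 := by
  induction s with
  | nil => simp [chart]
  | cons x s ih =>
    simp only [chart, List.length_append, List.length_map, length_row, List.length_cons,
      List.length_nil]
    nlinarith

/-- The longest suffix has the last row, whose last entry belongs to the whole string; the separator
after it leaves the accumulator unchanged. -/
theorem foldl_chart (hS : A.Computes S) (s : List T) (p : P) (hp : s = [] → p = A.empty) :
    (chart S s).foldl (fun q x => x.getD q) p = S s := by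
  obtain _ | ⟨x, s⟩ := s
  · simp [chart, hp, hS.nil]
  · obtain ⟨t, a, h⟩ : ∃ t a, x :: s = t ++ [a] :=
      ⟨_, _, (List.dropLast_append_getLast (List.cons_ne_nil x s)).symm⟩
    have := row_append S t a
    rw [← h] at this
    simp [chart, this]

/-- The time bound of the chart machine. -/
def time (n : ℕ) : ℕ := 6 * n ^ 3 + 2 * n ^ 2 + 2

theorem runs (hS : A.Computes S) (w : List T) :
    A.Runs (time w.length) (config (some .read) A.empty w [] [] [] [] [])
      (config none A.empty [] [A.accept (S w)] [] [] [] []) := by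
  obtain ⟨q, hq, h⟩ := runs_read (out := []) hS w [] A.empty
  have h' := h.trans (Runs.head (step_read_nil ..) (runs_finish _ _))
  rw [List.nil_append, foldl_chart hS w q hq] at h'
  refine h'.mono ?_
  have := length_chart (S := S) w
  simp only [List.length_nil, zero_add, time]
  nlinarith

open scoped Classical in
/-- The chart machine. -/
noncomputable def machine (A : ChartAlgebra T P) [Finite T] [Finite P] : Turing.FinTM2 :=
  letI : Fintype (Alphabet T P .input) := Fintype.ofFinite T
  letI : Fintype (Register T P) := @Fintype.ofFinite _ Register.finite
  { K := Stack
    k₀ := .input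
    k₁ := .output
    Γ := Alphabet T P
    Λ := Label
    main := .read
    σ := Register T P
    initialState := .clean A.empty
    m := A.program }

theorem recognizableInCubicTime [Finite T] [Finite P] (hS : A.Computes S) (L : Language T)
    (hL : ∀ w, A.accept (S w) = true ↔ w ∈ L) : RecognizableInCubicTime L := by
  have hout : ∀ w : List T, ∃ m ≤ time w.length,
      (flip bind A.machine.step)^[m] (some (Turing.initList A.machine w)) =
        some (Turing.haltList A.machine [A.accept (S w)]) := by
    intro w
    obtain ⟨m, hm, h⟩ := runs hS w
    refine ⟨m, hm, ?_⟩
    have h1 : Turing.initList A.machine w =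
        config (some .read) A.empty w [] [] [] [] [] := by
      refine congrArg (Turing.TM2.Cfg.mk _ _) (funext fun k => ?_)
      cases k <;> rfl
    have h2 : Turing.haltList A.machine [A.accept (S w)] =
        config none A.empty [] [A.accept (S w)] [] [] [] [] := by
      refine congrArg (Turing.TM2.Cfg.mk _ _) (funext fun k => ?_)
      cases k <;> rfl
    rw [h1, h2]
    exact h
  refine ⟨fun w => A.accept (S w),
    { tm := A.machine
      inputAlphabet := Equiv.refl T
      outputAlphabet := Equiv.refl Bool
      time := time
      outputsFun := fun w =>
        { steps := (hout w).choose
          evals_in_steps := ?_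
          steps_le_m := (hout w).choose_spec.1 } }, 10, hL, fun n hn => ?_⟩
  · have h := (hout w).choose_spec.2
    have h1 : (id w).map (Equiv.refl T).invFun = w := List.map_id w
    have h2 : ∀ l : List T, w = l → (flip bind A.machine.step)^[(hout w).choose]
        (some (Turing.initList A.machine l)) =
          some (Turing.haltList A.machine [A.accept (S w)]) := by
      rintro l rfl
      exact h
    exact h2 _ h1.symm
  -- For `n ≥ 1` every power in `time` is at most `n ^ 3`, and the coefficients add up to `6 + 2 + 2
  -- = 10`.
  · have h2 : n ^ 2 ≤ n ^ 3 := Nat.pow_le_pow_right hn (by norm_num)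
    have h3 : 1 ≤ n ^ 3 := Nat.one_le_pow _ _ hn
    simp only [time]
    omega

end ChartAlgebra

/-! ### Binary grammars and their chart parsers. -/

/-- A context-free grammar, possibly with infinitely many non-terminals, whose right-hand sides have
length at most two; a terminal only occurs alone. -/
structure BinaryGrammar (Q T : Type) where
  eps : Q → Prop
  term : Q → T → Prop
  unit : Q → Q → Prop
  bin : Q → Q → Q → Prop

namespace BinaryGrammar

variable {Q T : Type}

/-- The strings generated by a non-terminal. -/
inductive Derives (B : BinaryGrammar Q T) : Q → List T → Prop
  | eps {q : Q} (h : B.eps q) : Derives B q []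
  | term {q : Q} {a : T} (h : B.term q a) : Derives B q [a]
  | unit {q r : Q} {w : List T} (h : B.unit q r) (hr : Derives B r w) : Derives B q w
  | bin {q r s : Q} {u v : List T} (h : B.bin q r s) (hr : Derives B r u) (hs : Derives B s v) :
      Derives B q (u ++ v)

/-- A derivation step in which a non-terminal is replaced by another one, the erasure of a
non-terminal included. -/
def Chain (B : BinaryGrammar Q T) (q r : Q) : Prop :=
  B.unit q r ∨ ∃ s, B.Derives s [] ∧ (B.bin q r s ∨ B.bin q s r)

variable {B : BinaryGrammar Q T} {q r : Q} {w : List T}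

theorem Derives.of_chain (h : Relation.ReflTransGen B.Chain q r) (hr : B.Derives r w) :
    B.Derives q w := by
  induction h using Relation.ReflTransGen.head_induction_on with
  | refl => exact hr
  | head h _ ih =>
    obtain h | ⟨s, hs, h | h⟩ := h
    · exact .unit h ih
    · simpa using Derives.bin h ih hs
    · exact .bin h hs ih

/-- Following the only part with a non-empty yield down the derivation uses chain steps until a
terminal or a genuine split appears. This lets the chart ignore empty parts: `close` absorbs all
unit rules and erasures. -/
theorem Derives.exists_chain (h : B.Derives q w) (hw : w ≠ []) :
    ∃ r, Relation.ReflTransGen B.Chain q r ∧ ((∃ a, w = [a] ∧ B.term r a) ∨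
      ∃ s t u v, B.bin r s t ∧ u ≠ [] ∧ v ≠ [] ∧ w = u ++ v ∧ B.Derives s u ∧ B.Derives t v) := by
  induction h with
  | eps h => exact absurd rfl hw
  | @term q a h => exact ⟨q, .refl, .inl ⟨a, rfl, h⟩⟩
  | unit h hr ih =>
    obtain ⟨s, hs, H⟩ := ih hw
    exact ⟨s, .head (.inl h) hs, H⟩
  | @bin q r s u v h hr hs ihr ihs =>
    by_cases hu : u = []
    · subst hu
      obtain ⟨t, ht, H⟩ := ihs hw
      exact ⟨t, .head (.inr ⟨r, hr, .inr h⟩) ht, H⟩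
    · by_cases hv : v = []
      · subst hv
        obtain ⟨t, ht, H⟩ := ihr hu
        refine ⟨t, .head (.inr ⟨s, hs, .inl h⟩) ht, ?_⟩
        simpa using H
      · exact ⟨q, .refl, .inr ⟨r, s, u, v, h, hu, hv, rfl, hr, hs⟩⟩

/-- The set of the non-terminals that generate a string. -/
def value (B : BinaryGrammar Q T) (w : List T) : Set Q := {q | B.Derives q w}

open scoped Classical in
/-- Chart parsing for a binary grammar. -/
noncomputable def chartAlgebra (B : BinaryGrammar Q T) (start : Q) : ChartAlgebra T (Set Q) where
  empty := B.value []
  zero := ∅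
  letter a := {q | B.term q a}
  add p x y := p ∪ {q | ∃ r ∈ x, ∃ s ∈ y, B.bin q r s}
  close x := {q | ∃ r ∈ x, Relation.ReflTransGen B.Chain q r}
  accept x := decide (start ∈ x)

theorem mem_foldl_add (start : Q) (l : List (Set Q × Set Q)) (p : Set Q) :
    q ∈ l.foldl (fun p x => (B.chartAlgebra start).add p x.1 x.2) p ↔
      q ∈ p ∨ ∃ x ∈ l, ∃ r ∈ x.1, ∃ s ∈ x.2, B.bin q r s := by
  induction l generalizing p with
  | nil => simp
  | cons x l ih =>
    rw [List.foldl_cons, ih]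
    simp only [chartAlgebra, Set.mem_union, Set.mem_ofPred_eq, List.mem_cons, or_and_right,
      exists_or, exists_eq_left, or_assoc]

/-- The `k`-th entries are the values of `take (k + 1)` and of the matching remainder, so zipping
runs through all splits into two non-empty parts. -/
theorem mem_zip_row_col (S : List T → Set Q) (x : T) (s : List T) (a : T)
    (z : Set Q × Set Q) :
    z ∈ (ChartAlgebra.row S (x :: s)).zip (ChartAlgebra.col S a s) ↔
      ∃ u v, u ≠ [] ∧ v ≠ [] ∧ x :: s ++ [a] = u ++ v ∧ z = (S u, S v) := by
  rw [ChartAlgebra.row, ChartAlgebra.col_eq, List.length_cons, List.zip_map', List.mem_map]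
  constructor
  · rintro ⟨k, hk, rfl⟩
    rw [List.mem_range] at hk
    exact ⟨(x :: s).take (k + 1), s.drop k ++ [a], by simp, by simp, by
      simp [← List.append_assoc], rfl⟩
  · rintro ⟨u, v, hu, hv, h, rfl⟩
    obtain _ | ⟨y, u⟩ := u
    · exact absurd rfl hu
    · simp only [List.cons_append, List.cons.injEq] at h
      obtain ⟨rfl, h⟩ := h
      have hlen := congrArg List.length h
      have hv' := List.length_pos_of_ne_nil hv
      simp only [List.length_append, List.length_singleton] at hlen
      have h1 : u = s.take u.length := by
        have := congrArg (List.take u.length) h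
        rwa [List.take_append_of_le_length (by omega), List.take_left, eq_comm] at this
      have h2 : v = s.drop u.length ++ [a] := by
        have := congrArg (List.drop u.length) h
        rwa [List.drop_append_of_le_length (by omega), List.drop_left, eq_comm] at this
      refine ⟨u.length, List.mem_range.2 (by omega), ?_⟩
      rw [← h2, List.take_succ_cons, ← h1]

theorem computes (B : BinaryGrammar Q T) (start : Q) :
    (B.chartAlgebra start).Computes B.value where
  nil := rfl
  letter a := by
    ext q
    constructor
    · intro h
      obtain ⟨r, hr, ⟨b, hb, h⟩ | ⟨s, t, u, v, -, hu, hv, huv, -⟩⟩ := h.exists_chain (by simp)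
      · obtain rfl : a = b := by simpa using hb
        exact ⟨r, h, hr⟩
      · have := congrArg List.length huv
        have hu' := List.length_pos_of_ne_nil hu
        have hv' := List.length_pos_of_ne_nil hv
        simp only [List.length_singleton, List.length_append] at this
        omega
    · rintro ⟨r, h, hr⟩
      exact .of_chain hr (.term h)
  split x s a := by
    ext q
    constructor
    · intro h
      obtain ⟨r, hr, ⟨b, hb, h⟩ | ⟨t, t', u, v, h, hu, hv, huv, ht, ht'⟩⟩ :=
        h.exists_chain (by simp)
      · simp at hb
      · refine ⟨r, (mem_foldl_add ..).2
          (.inr ⟨(B.value u, B.value v), ?_, t, ht, t', ht', h⟩), hr⟩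
        exact (mem_zip_row_col ..).2 ⟨u, v, hu, hv, huv, rfl⟩
    · rintro ⟨r, h, hr⟩
      obtain h | ⟨z, hz, t, ht, t', ht', h⟩ := (mem_foldl_add ..).1 h
      · exact absurd h (Set.notMem_empty r)
      · obtain ⟨u, v, -, -, huv, rfl⟩ := (mem_zip_row_col ..).1 hz
        rw [huv]
        exact .of_chain hr (.bin h ht ht')

/-- A string language generated by a finite binary grammar can be recognized in cubic time. -/
theorem recognizableInCubicTime [Finite T] [Finite Q] (B : BinaryGrammar Q T) (start : Q) :
    RecognizableInCubicTime ({w | B.Derives start w} : Language T) :=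
  ChartAlgebra.recognizableInCubicTime (B.computes start) _ fun w => by
    simp [chartAlgebra, value]; rfl

/-- The set of non-terminals is closed under taking right-hand sides of rules. -/
structure IsClosed (B : BinaryGrammar Q T) (F : Set Q) : Prop where
  unit : ∀ q ∈ F, ∀ r, B.unit q r → r ∈ F
  bin : ∀ q ∈ F, ∀ r s, B.bin q r s → r ∈ F ∧ s ∈ F

/-- The grammar with fewer non-terminals. -/
def restrict (B : BinaryGrammar Q T) (F : Set Q) : BinaryGrammar F T where
  eps q := B.eps q
  term q a := B.term q a
  unit q r := B.unit q r
  bin q r s := B.bin q r s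

theorem IsClosed.derives_restrict {F : Set Q} (hF : B.IsClosed F) (q : F) :
    (B.restrict F).Derives q w ↔ B.Derives q w := by
  constructor
  · intro h
    induction h with
    | eps h => exact .eps h
    | term h => exact .term h
    | unit h _ ih => exact .unit h ih
    | bin h _ _ ih ih' => exact .bin h ih ih'
  · obtain ⟨q, hq⟩ := q
    intro h
    change B.Derives q w at h
    induction h with
    | eps h => exact .eps h
    | term h => exact .term h
    | @unit q r w h _ ih =>
      have hr : (B.restrict F).unit ⟨q, hq⟩ ⟨r, hF.unit q hq r h⟩ := h
      exact .unit hr (ih _)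
    | @bin q r s u v h _ _ ih ih' =>
      have hrs := hF.bin q hq r s h
      have h' : (B.restrict F).bin ⟨q, hq⟩ ⟨r, hrs.1⟩ ⟨s, hrs.2⟩ := h
      exact .bin h' (ih _) (ih' _)

/-- Reduces an infinite grammar to a finite one: derivations from an element of a closed set never
leave that set. -/
theorem IsClosed.recognizableInCubicTime [Finite T] {F : Set Q} (hF : B.IsClosed F)
    (hfin : F.Finite) (hq : q ∈ F) : RecognizableInCubicTime ({w | B.Derives q w} : Language T) := by
  have := hfin.to_subtype
  have h := (B.restrict F).recognizableInCubicTime ⟨q, hq⟩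
  simpa only [hF.derives_restrict] using h

end BinaryGrammar

/-! ### Trees, contexts and their decompositions. -/

namespace TagTree

variable {V W T : Type}

theorem induct {P : TagTree V T → Prop} (leaf : ∀ a, P (leaf a)) (foot : ∀ v, P (foot v))
    (node : ∀ v ts, (∀ t ∈ ts, P t) → P (node v ts)) (t : TagTree V T) : P t :=
  TagTree.rec (motive_1 := P) (motive_2 := fun ts => ∀ t ∈ ts, P t) leaf foot node
    (fun _ h => absurd h List.not_mem_nil)
    (fun _ _ h hs _ ht => (List.mem_cons.1 ht).elim (fun e => e ▸ h) (hs _)) t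

@[simp] theorem footFree_node (v : V) (ts : List (TagTree V T)) :
    (node v ts).FootFree ↔ ∀ t ∈ ts, t.FootFree :=
  ⟨fun h => by cases h; assumption, .node v ts⟩

@[simp] theorem not_footFree_foot (v : V) : ¬ (foot v : TagTree V T).FootFree := by
  intro h; cases h

theorem FootFree.map {t : TagTree V T} (h : t.FootFree) (f : V → W) : (t.map f).FootFree := by
  induction h with
  | leaf a => rw [TagTree.map]; exact .leaf a
  | node v ts _ ih =>
    rw [TagTree.map]
    refine .node _ _ fun t ht => ?_
    obtain ⟨t', ht', rfl⟩ := List.mem_map.1 ht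
    exact ih t' ht'

theorem FootFree.of_map {f : V → W} (t : TagTree V T) : (t.map f).FootFree → t.FootFree := by
  induction t using induct with
  | leaf a => exact fun _ => .leaf a
  | foot v => rw [TagTree.map]; exact fun h => absurd h (not_footFree_foot _)
  | node v ts ih =>
    rw [TagTree.map, footFree_node]
    exact fun h => .node v ts fun t ht => ih t ht (h _ (List.mem_map_of_mem ht))

theorem Completed.footFree {t : TagTree V T} (h : t.Completed) : t.FootFree := by
  induction h with
  | leaf a => exact .leaf a
  | node v ts _ _ ih => exact .node v ts ih

theorem rootLabel_map (f : V → W) (t : TagTree V T) :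
    (t.map f).rootLabel = t.rootLabel.map f := by
  cases t <;> rw [TagTree.map] <;> rfl

end TagTree

namespace TagCtx

variable {V W T : Type}

/-- Put a context into the hole of another one. -/
def comp : TagCtx V T → TagCtx V T → TagCtx V T
  | hole, D => D
  | node v l c r, D => node v l (c.comp D) r

@[simp] theorem hole_comp (D : TagCtx V T) : hole.comp D = D := rfl

@[simp] theorem node_comp (v : V) (l : List (TagTree V T)) (c : TagCtx V T)
    (r : List (TagTree V T)) (D : TagCtx V T) : (node v l c r).comp D = node v l (c.comp D) r := rfl

@[simp] theorem hole_fill (s : TagTree V T) : hole.fill s = s := rfl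

@[simp] theorem node_fill (v : V) (l : List (TagTree V T)) (c : TagCtx V T)
    (r : List (TagTree V T)) (s : TagTree V T) :
    (node v l c r).fill s = TagTree.node v (l ++ c.fill s :: r) := rfl

@[simp] theorem comp_hole (C : TagCtx V T) : C.comp hole = C := by
  induction C with
  | hole => rfl
  | node v l c r ih => rw [node_comp, ih]

@[simp] theorem fill_comp (C D : TagCtx V T) (s : TagTree V T) :
    (C.comp D).fill s = C.fill (D.fill s) := by
  induction C with
  | hole => rfl
  | node v l c r ih => rw [node_comp, node_fill, node_fill, ih]

@[simp] theorem path_comp (C D : TagCtx V T) : (C.comp D).path = C.path ++ D.path := by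
  induction C with
  | hole => rfl
  | node v l c r ih => simp [path, ih]

@[simp] theorem footFree_comp (C D : TagCtx V T) :
    (C.comp D).FootFree ↔ C.FootFree ∧ D.FootFree := by
  induction C with
  | hole => simp [FootFree]
  | node v l c r ih => simp only [node_comp, FootFree, ih]; tauto

@[simp] theorem footFree_fill (C : TagCtx V T) (s : TagTree V T) :
    (C.fill s).FootFree ↔ C.FootFree ∧ s.FootFree := by
  induction C with
  | hole => simp [FootFree]
  | node v l c r ih =>
    simp only [node_fill, FootFree, TagTree.footFree_node, List.mem_append, List.mem_cons,
      or_imp, forall_and, forall_eq, ih]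
    tauto

@[simp] theorem footFree_mapPath (f : V → V) (C : TagCtx V T) :
    (C.mapPath f).FootFree ↔ C.FootFree := by
  induction C with
  | hole => rfl
  | node v l c r ih => simp only [mapPath, FootFree, ih]

theorem mapPath_comp (f : V → V) (C D : TagCtx V T) :
    (C.comp D).mapPath f = (C.mapPath f).comp (D.mapPath f) := by
  induction C with
  | hole => rfl
  | node v l c r ih => simp only [node_comp, mapPath, ih]

/-- Apply a function to all non-terminal labels. -/
def map (f : V → W) : TagCtx V T → TagCtx W T
  | hole => hole
  | node v l c r => node (f v) (l.map (TagTree.map f)) (c.map f) (r.map (TagTree.map f))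

theorem map_fill (f : V → W) (C : TagCtx V T) (s : TagTree V T) :
    (C.fill s).map f = (C.map f).fill (s.map f) := by
  induction C with
  | hole => rfl
  | node v l c r ih => simp [map, TagTree.map, ih]

theorem FootFree.map {C : TagCtx V T} (h : C.FootFree) (f : V → W) : (C.map f).FootFree := by
  induction C with
  | hole => exact h
  | node v l c r ih =>
    refine ⟨fun t ht => ?_, ih h.2.1, fun t ht => ?_⟩ <;> 
      obtain ⟨t', ht', rfl⟩ := List.mem_map.1 ht
    · exact (h.1 t' ht').map f
    · exact (h.2.2 t' ht').map f

theorem fill_eq_foot {C : TagCtx V T} {s : TagTree V T} {v : V}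
    (h : C.fill s = TagTree.foot v) : C = hole ∧ s = TagTree.foot v := by
  cases C with
  | hole => exact ⟨rfl, h⟩
  | node => simp at h

theorem append_cons_eq_append_cons {α : Type} {l l' r r' : List α} {x y : α}
    (h : l ++ x :: r = l' ++ y :: r') :
    (∃ m, l = l' ++ y :: m ∧ r' = m ++ x :: r) ∨ (l = l' ∧ x = y ∧ r = r') ∨
      ∃ m, l' = l ++ x :: m ∧ r = m ++ y :: r' := by
  induction l generalizing l' with
  | nil =>
    cases l' with
    | nil => exact .inr (.inl ⟨rfl, by simpa using h⟩)
    | cons z l' =>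
      simp only [List.nil_append, List.cons_append, List.cons.injEq] at h
      exact .inr (.inr ⟨l', by simp [h.1], h.2⟩)
  | cons w l ih =>
    cases l' with
    | nil =>
      simp only [List.nil_append, List.cons_append, List.cons.injEq] at h
      exact .inl ⟨l, by simp [h.1], h.2.symm⟩
    | cons z l' =>
      simp only [List.cons_append, List.cons.injEq] at h
      obtain ⟨rfl, h⟩ := h
      obtain ⟨m, rfl, h'⟩ | ⟨rfl, h'⟩ | ⟨m, rfl, h'⟩ := ih h
      · exact .inl ⟨m, rfl, h'⟩
      · exact .inr (.inl ⟨rfl, h'⟩)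
      · exact .inr (.inr ⟨m, rfl, h'⟩)

/-- If a tree is decomposed in two ways, then either the distinguished node of the second
decomposition lies above the one of the first, or it lies in a tree that hangs off the path
to the first one, or it lies below. The last case is excluded for a foot. -/
theorem fill_foot_eq_fill {D C : TagCtx V T} {v : V} {s : TagTree V T}
    (h : D.fill (TagTree.foot v) = C.fill s) :
    (∃ F, D = C.comp F ∧ s = F.fill (TagTree.foot v)) ∨
    (∃ (E : TagCtx V T) (u : V) (l : List (TagTree V T)) (B : TagCtx V T) (m : List (TagTree V T))
      (c : TagCtx V T) (r : List (TagTree V T)), D = E.comp (node u (l ++ B.fill s :: m) c r) ∧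
      C = E.comp (node u l B (m ++ c.fill (TagTree.foot v) :: r))) ∨
    ∃ (E : TagCtx V T) (u : V) (l : List (TagTree V T)) (B : TagCtx V T) (m : List (TagTree V T))
      (c : TagCtx V T) (r : List (TagTree V T)), D = E.comp (node u l c (m ++ B.fill s :: r)) ∧
      C = E.comp (node u (l ++ c.fill (TagTree.foot v) :: m) B r) := by
  induction C generalizing D with
  | hole => exact .inl ⟨D, rfl, h.symm⟩
  | node w l' B r' ih =>
    cases D with
    | hole => simp at h
    | node u l c r =>
      simp only [node_fill, TagTree.node.injEq] at h
      obtain ⟨rfl, h⟩ := h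
      obtain ⟨m, rfl, rfl⟩ | ⟨rfl, h', rfl⟩ | ⟨m, rfl, rfl⟩ := append_cons_eq_append_cons h
      · exact .inr (.inl ⟨hole, u, l', B, m, c, r, rfl, rfl⟩)
      · obtain ⟨F, rfl, hs⟩ | ⟨E, u', l', B', m, c', r', rfl, rfl⟩ |
          ⟨E, u', l', B', m, c', r', rfl, rfl⟩ := ih h'
        · exact .inl ⟨F, rfl, hs⟩
        · exact .inr (.inl ⟨node u l E r, u', l', B', m, c', r', rfl, rfl⟩)
        · exact .inr (.inr ⟨node u l E r, u', l', B', m, c', r', rfl, rfl⟩)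
      · exact .inr (.inr ⟨hole, u, l, B, m, c, r', rfl, rfl⟩)

/-- A different position for the second foot would place it in a tree hanging off the path, which
contains no foot. -/
theorem FootFree.eq_of_fill_foot {D C : TagCtx V T} {v w : V} (hD : D.FootFree)
    (h : D.fill (TagTree.foot v) = C.fill (TagTree.foot w)) : D = C ∧ v = w := by
  obtain ⟨F, rfl, hs⟩ | ⟨E, u, l, B, m, c, r, rfl, rfl⟩ | ⟨E, u, l, B, m, c, r, rfl, rfl⟩ :=
    fill_foot_eq_fill h
  · obtain ⟨rfl, hs⟩ := fill_eq_foot hs.symm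
    exact ⟨comp_hole C, by simpa using hs.symm⟩
  · simp [FootFree, or_imp, forall_and] at hD
  · simp [FootFree, or_imp, forall_and] at hD

end TagCtx

/-! ### Dominance: larger records allow fewer adjunctions. -/

open TreeAdjoiningGrammar (SpineLabel)

/-- The non-terminals of a binary grammar for trees with spine labels: a tree, a tree at the root of
which there is no further adjunction, and a sequence of trees. -/
inductive TagItem (N : Type) (T : Type) : Type
  | tree : TagTree (SpineLabel N) T → TagItem N T
  | body : TagTree (SpineLabel N) T → TagItem N T
  | forest : List (TagTree (SpineLabel N) T) → TagItem N T

namespace TreeAdjoiningGrammar.SpineLabel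

variable {N : Type}

/-- The label of a node that does not lie inside the spine of an adjoined tree. -/
def fresh (X : N) : SpineLabel N := ⟨X, ∅⟩

/-- The label of a node that moreover lies inside the spines of some trees. -/
def enlarge (K : Set N) (v : SpineLabel N) : SpineLabel N := ⟨v.sym, v.inner ∪ K⟩

/-- The label of a node that lies inside the spine of an adjoined tree with root label `X`. -/
def enclose (X : N) (K : Set N) (v : SpineLabel N) : SpineLabel N :=
  ⟨v.sym, insert X (v.inner ∪ K)⟩

/-- The labels have the same non-terminal, and the first one allows fewer adjunctions. -/
structure Dominates (v' v : SpineLabel N) : Prop where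
  sym : v'.sym = v.sym
  inner : v.inner ⊆ v'.inner

theorem Dominates.refl (v : SpineLabel N) : Dominates v v := ⟨rfl, subset_rfl⟩

end TreeAdjoiningGrammar.SpineLabel

open TreeAdjoiningGrammar.SpineLabel (fresh enlarge enclose)

namespace TagCtx

variable {N T : Type}

/-- The contexts differ only in the records on the path to the hole, and the first one allows
fewer adjunctions. -/
inductive Dominates : TagCtx (SpineLabel N) T → TagCtx (SpineLabel N) T → Prop
  | hole : Dominates hole hole
  | node {v' v : SpineLabel N} {l r : List (TagTree (SpineLabel N) T)}
      {c' c : TagCtx (SpineLabel N) T} (hv : SpineLabel.Dominates v' v) (hc : Dominates c' c) :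
      Dominates (node v' l c' r) (node v l c r)

theorem Dominates.refl (C : TagCtx (SpineLabel N) T) : Dominates C C := by
  induction C with
  | hole => exact .hole
  | node v l c r ih => exact .node (.refl v) ih

theorem Dominates.comp {C' C D' D : TagCtx (SpineLabel N) T} (hC : Dominates C' C)
    (hD : Dominates D' D) : Dominates (C'.comp D') (C.comp D) := by
  induction hC with
  | hole => exact hD
  | node hv _ ih => exact .node hv ih

theorem Dominates.mapPath {f g : SpineLabel N → SpineLabel N}
    (h : ∀ v, SpineLabel.Dominates (f v) (g v)) (C : TagCtx (SpineLabel N) T) :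
    Dominates (C.mapPath f) (C.mapPath g) := by
  induction C with
  | hole => exact .hole
  | node v l c r ih => exact .node (h v) ih

end TagCtx

namespace TagTree

variable {N T : Type}

/-- The congruence generated by a relation between trees and by dominance of labels. -/
inductive Dominates (ρ : TagTree (SpineLabel N) T → TagTree (SpineLabel N) T → Prop) :
    TagTree (SpineLabel N) T → TagTree (SpineLabel N) T → Prop
  | base {t' t : TagTree (SpineLabel N) T} (h : ρ t' t) : Dominates ρ t' t
  | leaf (a : Option T) : Dominates ρ (leaf a) (leaf a)
  | foot (v : SpineLabel N) : Dominates ρ (foot v) (foot v)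
  | node {v' v : SpineLabel N} {ts' ts : List (TagTree (SpineLabel N) T)}
      (hv : SpineLabel.Dominates v' v) (hts : List.Forall₂ (Dominates ρ) ts' ts) :
      Dominates ρ (node v' ts') (node v ts)

variable {ρ : TagTree (SpineLabel N) T → TagTree (SpineLabel N) T → Prop}

theorem Dominates.refl (t : TagTree (SpineLabel N) T) : Dominates ρ t t := by
  induction t using induct with
  | leaf a => exact .leaf a
  | foot v => exact .foot v
  | node v ts ih => exact .node (.refl v) (List.forall₂_same.2 ih)

theorem Dominates.append_cons {t' t : TagTree (SpineLabel N) T} (h : Dominates ρ t' t)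
    (l r : List (TagTree (SpineLabel N) T)) :
    List.Forall₂ (Dominates ρ) (l ++ t' :: r) (l ++ t :: r) :=
  List.rel_append (List.forall₂_same.2 fun t _ => .refl t)
    (.cons h (List.forall₂_same.2 fun t _ => .refl t))

theorem Dominates.fill {t' t : TagTree (SpineLabel N) T} (h : Dominates ρ t' t)
    {C' C : TagCtx (SpineLabel N) T} (hC : C'.Dominates C) :
    Dominates ρ (C'.fill t') (C.fill t) := by
  induction hC with
  | hole => exact h
  | node hv _ ih => exact .node hv (ih.append_cons _ _)

end TagTree

namespace TagItem

variable {N T : Type}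

/-- The relation between items induced by a relation between trees. -/
inductive Dominates (ρ : TagTree (SpineLabel N) T → TagTree (SpineLabel N) T → Prop) :
    TagItem N T → TagItem N T → Prop
  | tree {t' t : TagTree (SpineLabel N) T} (h : TagTree.Dominates ρ t' t) :
      Dominates ρ (tree t') (tree t)
  | leaf (a : Option T) : Dominates ρ (body (.leaf a)) (body (.leaf a))
  | foot (v : SpineLabel N) : Dominates ρ (body (.foot v)) (body (.foot v))
  | node {v' v : SpineLabel N} {ts' ts : List (TagTree (SpineLabel N) T)}
      (hv : SpineLabel.Dominates v' v) (hts : List.Forall₂ (TagTree.Dominates ρ) ts' ts) :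
      Dominates ρ (body (.node v' ts')) (body (.node v ts))
  | forest {ts' ts : List (TagTree (SpineLabel N) T)}
      (hts : List.Forall₂ (TagTree.Dominates ρ) ts' ts) : Dominates ρ (forest ts') (forest ts)

theorem Dominates.body_fill {ρ : TagTree (SpineLabel N) T → TagTree (SpineLabel N) T → Prop}
    {t' t : TagTree (SpineLabel N) T} (h : TagTree.Dominates ρ t' t)
    {C' C : TagCtx (SpineLabel N) T} (hC : C'.Dominates C) (hne : C ≠ .hole) :
    Dominates ρ (body (C'.fill t')) (body (C.fill t)) := by
  cases hC with
  | hole => exact absurd rfl hne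
  | node hv hC => exact .node hv ((h.fill hC).append_cons _ _)

end TagItem

/-! ### The top-down grammar and simulations. -/

namespace TreeAdjoiningGrammar

variable {N T : Type}

theorem unmarked_eq (t : TagTree N T) : unmarked t = t.map fresh := rfl

theorem markSpine_node (X : N) (K : Set N) (v : SpineLabel N)
    (l r : List (TagTree (SpineLabel N) T)) (c : TagCtx (SpineLabel N) T) :
    markSpine X K (.node v l c r) = .node (enlarge K v) l (c.mapPath (enclose X K)) r := rfl

theorem markSpine_dominates {K K' : Set N} (X : N) (h : K ⊆ K') (D : TagCtx (SpineLabel N) T) :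
    (markSpine X K' D).Dominates (markSpine X K D) := by
  cases D with
  | hole => exact .hole
  | node v l c r =>
    exact .node ⟨rfl, Set.union_subset_union_right _ h⟩ (.mapPath (f := enclose X K')
      (g := enclose X K) (fun v => ⟨rfl,
      Set.insert_subset_insert (Set.union_subset_union_right _ h)⟩) c)

/-- The auxiliary tree with foot label `X` and context `D` is an elementary tree. -/
structure IsAux (G : TreeAdjoiningGrammar N T) (D : TagCtx N T) (X : N) : Prop where
  footFree : D.FootFree
  mem : D.fill (TagTree.foot X) ∈ G.auxiliary
  root : (D.fill (TagTree.foot X)).rootLabel = some X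

/-- The rules with a single item on the right-hand side. -/
inductive Rewrites (G : TreeAdjoiningGrammar N T) : TagItem N T → TagItem N T → Prop
  | body (s : TagTree (SpineLabel N) T) : Rewrites G (.tree s) (.body s)
  | adjoin {D : TagCtx N T} {X : N} (s : TagTree (SpineLabel N) T) (u : SpineLabel N)
      (hD : G.IsAux D X) (hne : D ≠ .hole) (hs : s.rootLabel = some u) (hu : u.sym = X)
      (hin : ∀ Z ∈ u.inner, Z ∉ spineLabels (D.map fresh : TagCtx (SpineLabel N) T) (fresh X)) :
      Rewrites G (.tree s) (.body ((markSpine X u.inner (D.map fresh)).fill s))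
  | children (u : SpineLabel N) (ts : List (TagTree (SpineLabel N) T)) (hne : ts ≠ []) :
      Rewrites G (.body (.node u ts)) (.forest ts)
  | substitute (t : TagTree N T) (u : SpineLabel N) (ht : t ∈ G.initial)
      (hroot : t.rootLabel = some u.sym) :
      Rewrites G (.body (.node u [])) (.tree (unmarked t))

/-- A binary grammar for the yields of the trees that result from top-down regular adjunction of
elementary trees. -/
def regularGrammar (G : TreeAdjoiningGrammar N T) : BinaryGrammar (TagItem N T) T where
  eps i := i = .body (.leaf none) ∨ i = .forest []
  term i a := i = .body (.leaf (some a))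
  unit := G.Rewrites
  bin i j k := ∃ t ts, i = .forest (t :: ts) ∧ j = .tree t ∧ k = .forest ts

/-- The string can be derived from the item. -/
abbrev Generates (G : TreeAdjoiningGrammar N T) (i : TagItem N T) (w : List T) : Prop :=
  G.regularGrammar.Derives i w

variable {G : TreeAdjoiningGrammar N T}

theorem Generates.rewrite {i j : TagItem N T} {w : List T} (h : G.Rewrites i j)
    (hj : G.Generates j w) : G.Generates i w :=
  BinaryGrammar.Derives.unit h hj

/-- The roots of two trees have labels one of which dominates the other one. -/
def RootDominates (t' t : TagTree (SpineLabel N) T) : Prop :=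
  ∀ u', t'.rootLabel = some u' → ∃ u, t.rootLabel = some u ∧ u'.Dominates u

/-- A relation between trees respected by the generated languages, provided that there is no
adjunction at the root of the first tree. -/
def IsSimulation (G : TreeAdjoiningGrammar N T)
    (ρ : TagTree (SpineLabel N) T → TagTree (SpineLabel N) T → Prop) : Prop :=
  ∀ t' t, ρ t' t → RootDominates t' t ∧
    ∀ w, G.Generates (.body t') w → G.Generates (.tree t) w

theorem IsSimulation.generates {ρ : TagTree (SpineLabel N) T → TagTree (SpineLabel N) T → Prop}
    (hρ : G.IsSimulation ρ) {i' i : TagItem N T} {w : List T} (h : G.Generates i' w)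
    (hi : TagItem.Dominates ρ i' i) : G.Generates i w := by
  induction h generalizing i with
  | eps h =>
    obtain rfl | rfl := h
    · cases hi
      exact .eps (.inl rfl)
    · cases hi with
      | forest hts =>
        cases hts
        exact .eps (.inr rfl)
  | term h =>
    cases h
    cases hi
    exact .term rfl
  | bin h _ _ ih₁ ih₂ =>
    obtain ⟨t', ts', rfl, rfl, rfl⟩ := h
    cases hi with
    | forest hts =>
      cases hts with
      | cons ht hts => exact .bin ⟨_, _, rfl, rfl, rfl⟩ (ih₁ (.tree ht)) (ih₂ (.forest hts))
  | unit h hr ih =>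
    cases h with
    | body s' =>
      cases hi with
      | tree ht =>
        cases ht with
        | base h => exact (hρ _ _ h).2 _ hr
        | leaf a => exact .rewrite (.body _) (ih (.leaf a))
        | foot v => exact .rewrite (.body _) (ih (.foot v))
        | node hv hts => exact .rewrite (.body _) (ih (.node hv hts))
    | @adjoin D X s' u' hD hne hs hu hin =>
      cases hi with
      | @tree _ s ht =>
        obtain ⟨u, hs, huu⟩ : ∃ u, s.rootLabel = some u ∧ u'.Dominates u := by
          cases ht with
          | base h => exact (hρ _ _ h).1 _ hs
          | leaf a => simp [TagTree.rootLabel] at hs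
          | foot v => exact ⟨u', hs, .refl u'⟩
          | node hv hts =>
            obtain rfl : _ = u' := by simpa [TagTree.rootLabel] using hs
            exact ⟨_, rfl, hv⟩
        refine .rewrite (.adjoin s u hD hne hs (huu.sym.symm.trans hu)
          fun Z hZ => hin Z (huu.inner hZ))
          (ih (.body_fill ht (markSpine_dominates X huu.inner _) ?_))
        cases D with
        | hole => exact absurd rfl hne
        | node => simp [TagCtx.map, markSpine_node]
    | children u ts hne =>
      cases hi with
      | node hv hts =>
        refine .rewrite (.children _ _ ?_) (ih (.forest hts))
        rintro rfl
        cases hts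
        exact hne rfl
    | substitute t u ht hroot =>
      cases hi with
      | node hv hts =>
        cases hts
        exact .rewrite (.substitute t _ ht (hv.sym ▸ hroot)) (ih (.tree (.refl _)))

/-- Replacing a tree inside another one by a tree that generates more strings. -/
theorem generates_fill {s' s : TagTree (SpineLabel N) T} (hroot : RootDominates s' s)
    (hs : ∀ w, G.Generates (.tree s') w → G.Generates (.tree s) w)
    {C' C : TagCtx (SpineLabel N) T} (hC : C'.Dominates C) {w : List T}
    (h : G.Generates (.tree (C'.fill s')) w) : G.Generates (.tree (C.fill s)) w := by
  have hρ : G.IsSimulation fun t' t => t' = s' ∧ t = s := by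
    rintro _ _ ⟨rfl, rfl⟩
    exact ⟨hroot, fun w hw => hs w (.rewrite (.body _) hw)⟩
  exact hρ.generates h (.tree (.fill (.base ⟨rfl, rfl⟩) hC))

theorem RootDominates.refl (s : TagTree (SpineLabel N) T) : RootDominates s s :=
  fun u hu => ⟨u, hu, .refl u⟩

end TreeAdjoiningGrammar

/-! ### Regular derivations are covered by the top-down grammar. -/

namespace TagTree

variable {N T : Type}

/-- The nodes marked for substitution do not lie inside the spine of an adjoined tree. -/
inductive Clean : TagTree (SpineLabel N) T → Prop
  | leaf (a : Option T) : Clean (leaf a)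
  | foot (v : SpineLabel N) : Clean (foot v)
  | node (v : SpineLabel N) (ts : List (TagTree (SpineLabel N) T)) (hv : ts = [] → v.inner = ∅)
      (h : ∀ t ∈ ts, Clean t) : Clean (node v ts)

theorem clean_map_fresh (t : TagTree N T) : (t.map fresh).Clean := by
  induction t using induct with
  | leaf a => rw [TagTree.map]; exact .leaf a
  | foot v => rw [TagTree.map]; exact .foot _
  | node v ts ih =>
    rw [TagTree.map]
    refine .node _ _ (fun _ => rfl) fun t ht => ?_
    obtain ⟨t', ht', rfl⟩ := List.mem_map.1 ht
    exact ih t' ht'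

end TagTree

namespace TagCtx

variable {N T : Type}

/-- The trees hanging off the path to the hole are clean. -/
def Clean : TagCtx (SpineLabel N) T → Prop
  | hole => True
  | node _ l c r => (∀ t ∈ l, t.Clean) ∧ c.Clean ∧ ∀ t ∈ r, t.Clean

theorem clean_fill (C : TagCtx (SpineLabel N) T) (s : TagTree (SpineLabel N) T) :
    (C.fill s).Clean ↔ C.Clean ∧ s.Clean := by
  induction C with
  | hole => simp [Clean]
  | node v l c r ih =>
    have h : (TagTree.node v (l ++ c.fill s :: r)).Clean ↔
        ∀ t ∈ l ++ c.fill s :: r, t.Clean :=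
      ⟨fun h => by cases h; assumption, .node _ _ fun h => by simp at h⟩
    rw [node_fill, h]
    simp only [Clean, List.mem_append, List.mem_cons, or_imp, forall_and, forall_eq, ih]
    tauto

theorem clean_mapPath (f : SpineLabel N → SpineLabel N) (C : TagCtx (SpineLabel N) T) :
    (C.mapPath f).Clean ↔ C.Clean := by
  induction C with
  | hole => rfl
  | node v l c r ih => simp only [mapPath, Clean, ih]

theorem Dominates.mapPath_mapPath {f g h : SpineLabel N → SpineLabel N}
    (H : ∀ v, SpineLabel.Dominates (g (f v)) (h v)) (C : TagCtx (SpineLabel N) T) :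
    Dominates ((C.mapPath f).mapPath g) (C.mapPath h) := by
  induction C with
  | hole => exact .hole
  | node v l c r ih => exact .node (H v) ih

theorem path_mapPath_sym {f : SpineLabel N → SpineLabel N} (hf : ∀ v, (f v).sym = v.sym)
    (C : TagCtx (SpineLabel N) T) :
    (C.mapPath f).path.map SpineLabel.sym = C.path.map SpineLabel.sym := by
  induction C with
  | hole => rfl
  | node v l c r ih => simp [mapPath, path, ih, hf]

end TagCtx

namespace TreeAdjoiningGrammar

variable {N T : Type} {G : TreeAdjoiningGrammar N T}

theorem footFree_markSpine (X : N) (K : Set N) (D : TagCtx (SpineLabel N) T) :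
    (markSpine X K D).FootFree ↔ D.FootFree := by
  cases D with
  | hole => rfl
  | node v l c r => simp only [markSpine_node, TagCtx.FootFree, TagCtx.footFree_mapPath]

theorem clean_markSpine (X : N) (K : Set N) (D : TagCtx (SpineLabel N) T) :
    (markSpine X K D).Clean ↔ D.Clean := by
  cases D with
  | hole => rfl
  | node v l c r => simp only [markSpine_node, TagCtx.Clean, TagCtx.clean_mapPath]

theorem path_markSpine (X : N) (K : Set N) (D : TagCtx (SpineLabel N) T) :
    (markSpine X K D).path.map SpineLabel.sym = D.path.map SpineLabel.sym := by
  cases D with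
  | hole => rfl
  | node v l c r =>
    simp [markSpine_node, TagCtx.path, TagCtx.path_mapPath_sym (f := enclose X K) (fun _ => rfl),
      enlarge]

theorem markSpine_node_comp (X : N) (K : Set N) (v : SpineLabel N)
    (l r : List (TagTree (SpineLabel N) T)) (c E : TagCtx (SpineLabel N) T) :
    markSpine X K ((TagCtx.node v l c r).comp E) =
      (markSpine X K (.node v l c r)).comp (E.mapPath (enclose X K)) := by
  rw [TagCtx.node_comp, markSpine_node, markSpine_node, TagCtx.mapPath_comp, TagCtx.node_comp]

theorem mapPath_enclose_dominates (X : N) (K : Set N) (D : TagCtx (SpineLabel N) T) :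
    (D.mapPath (enclose X K)).Dominates (markSpine X K D) := by
  cases D with
  | hole => exact .hole
  | node v l c r => exact .node ⟨rfl, Set.subset_insert _ _⟩ (.refl _)

theorem mapPath_markSpine_dominates {X Y : N} {K J J' : Set N} (h : J' ⊆ insert X (J ∪ K))
    (D : TagCtx (SpineLabel N) T) :
    ((markSpine Y J D).mapPath (enclose X K)).Dominates (markSpine Y J' D) := by
  have h' : ∀ Z ∈ J', Z = X ∨ Z ∈ J ∨ Z ∈ K := fun Z hZ => h hZ
  cases D with
  | hole => exact .hole
  | node v l c r =>
    refine .node ⟨rfl, ?_⟩ (.mapPath_mapPath (f := enclose Y J) (g := enclose X K)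
      (h := enclose Y J') (fun u => ⟨rfl, ?_⟩) c)
    · rintro Z (hZ | hZ)
      · exact .inr (.inl (.inl hZ))
      · obtain hZ | hZ | hZ := h' Z hZ
        · exact .inl hZ
        · exact .inr (.inl (.inr hZ))
        · exact .inr (.inr hZ)
    · rintro Z (hZ | hZ | hZ)
      · exact .inr (.inl (.inl hZ))
      · exact .inr (.inl (.inr (.inl hZ)))
      · obtain hZ | hZ | hZ := h' Z hZ
        · exact .inl hZ
        · exact .inr (.inl (.inr (.inr hZ)))
        · exact .inr (.inr hZ)

/-- For adjunction at the root or foot of the host: on the left the outer tree is marked after the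
inner one has been inserted, on the right they are separate. The right-hand order leaves fewer
marks, hence generates at least as much. -/
theorem markSpine_markSpine_comp_dominates {X Y : N} {K J J' : Set N} (h : J' ⊆ J ∪ K)
    {D : TagCtx (SpineLabel N) T} (hD : D ≠ .hole) (F : TagCtx (SpineLabel N) T) :
    (markSpine X K ((markSpine Y J D).comp F)).Dominates
      ((markSpine Y J' D).comp (markSpine X K F)) := by
  cases D with
  | hole => exact absurd rfl hD
  | node v l c r =>
    rw [markSpine_node, markSpine_node_comp]
    refine .comp ?_ (mapPath_enclose_dominates X K F)
    rw [markSpine_node, markSpine_node]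
    refine .node ⟨rfl, ?_⟩ (.mapPath_mapPath (f := enclose Y J) (g := enclose X K)
      (h := enclose Y J') (fun u => ⟨rfl, ?_⟩) c)
    · rintro Z (hZ | hZ)
      · exact .inl (.inl hZ)
      · obtain hZ | hZ := h hZ
        · exact .inl (.inr hZ)
        · exact .inr hZ
    · rintro Z (hZ | hZ | hZ)
      · exact .inr (.inl (.inl hZ))
      · exact .inr (.inl (.inr (.inl hZ)))
      · obtain hZ | hZ := h hZ
        · exact .inr (.inl (.inr (.inr hZ)))
        · exact .inr (.inr hZ)

/-- The top-down derivations cover the adjunction of the auxiliary tree with root label `X` and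
context `D`. -/
def AdjunctionSound (G : TreeAdjoiningGrammar N T) (D : TagCtx (SpineLabel N) T) (X : N) : Prop :=
  ∀ s u, s.rootLabel = some u → u.sym = X →
    (∀ Z ∈ u.inner, Z ∉ D.path.map SpineLabel.sym ++ [X]) →
    ∀ w, G.Generates (.tree ((markSpine X u.inner D).fill s)) w → G.Generates (.tree s) w

theorem rootDominates_markSpine {D : TagCtx (SpineLabel N) T} {v u : SpineLabel N}
    {s : TagTree (SpineLabel N) T} (X : N)
    (hD : (D.fill (.foot v)).rootLabel.map SpineLabel.sym = some u.sym)
    (hs : s.rootLabel = some u) : RootDominates ((markSpine X u.inner D).fill s) s := by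
  cases D with
  | hole => exact .refl s
  | node d l c r =>
    intro u' hu'
    obtain rfl : enlarge u.inner d = u' := by
      simpa [markSpine_node, TagTree.rootLabel] using hu'
    exact ⟨u, hs, by simpa [TagTree.rootLabel, enlarge] using hD, Set.subset_union_right⟩

theorem rootLabel_markSpine {D : TagCtx (SpineLabel N) T} {v u : SpineLabel N}
    {s : TagTree (SpineLabel N) T} (X : N) (K : Set N)
    (hD : (D.fill (.foot v)).rootLabel.map SpineLabel.sym = some u.sym)
    (hs : s.rootLabel = some u) :
    ((markSpine X K D).fill s).rootLabel.map SpineLabel.sym =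
      s.rootLabel.map SpineLabel.sym := by
  cases D with
  | hole => rfl
  | node d l c r =>
    rw [hs]
    simpa [markSpine_node, TagTree.rootLabel, enlarge] using hD

/-- The rule `adjoin` closes the new root, so later adjunctions there must be accounted for: they
are performed at `s` beforehand, and the elementary tree then goes to the resulting foot. The
relation between a tree and its extension is therefore a simulation. -/
theorem IsAux.adjunctionSound {D : TagCtx N T} {X : N} (hD : G.IsAux D X) :
    G.AdjunctionSound (D.map fresh) X := by
  intro s u hs hu hdisj w hw
  by_cases hne : D = .hole
  · subst hne
    exact hw
  · have hroot : ((D.map fresh : TagCtx (SpineLabel N) T).fill (.foot (fresh X))).rootLabel.map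
        SpineLabel.sym = some X := by
      have := hD.root
      cases D with
      | hole => exact absurd rfl hne
      | node v l c r => simpa [TagCtx.map, TagTree.rootLabel, fresh] using this
    have hρ : G.IsSimulation fun t' t => ∃ u, t.rootLabel = some u ∧ u.sym = X ∧
        (∀ Z ∈ u.inner, Z ∉ (D.map fresh).path.map SpineLabel.sym ++ [X]) ∧
        t' = (markSpine X u.inner (D.map fresh)).fill t := by
      rintro _ t ⟨u, ht, hu, hdisj, rfl⟩
      exact ⟨rootDominates_markSpine X (hu ▸ hroot) ht,
        fun w hw => .rewrite (.adjoin t u hD hne ht hu hdisj) hw⟩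
    exact hρ.generates hw (.tree (.base ⟨u, hs, hu, hdisj, rfl⟩))

/-- Instead of inserting `D` into the host first, the host is adjoined to `s` and then `D` at the
corresponding node. This node has record `k'`, and the task is to see that `k'` avoids the spine of
`D`, and that the reordered tree carries no larger records. -/
theorem AdjunctionSound.adjoin {C F D : TagCtx (SpineLabel N) T} {x u v : SpineLabel N}
    (hCF : G.AdjunctionSound (C.comp F) x.sym) (hD : G.AdjunctionSound D v.sym)
    (hu : (F.fill (.foot x)).rootLabel = some u) (huv : v.sym = u.sym)
    (hroot : (D.fill (.foot v)).rootLabel.map SpineLabel.sym = some v.sym)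
    (hhost : C = .hole ∨ F = .hole ∨ x.sym ∉ spineLabels D v)
    (hin : ∀ Z ∈ u.inner, Z ∉ spineLabels D v) :
    G.AdjunctionSound (C.comp ((markSpine v.sym u.inner D).comp F)) x.sym := by
  by_cases hne : D = .hole
  · subst hne
    exact hCF
  intro s k hs hk hdisj w hw
  simp only [TagCtx.path_comp, List.map_append, path_markSpine, List.mem_append,
    List.mem_singleton, not_or] at hdisj
  have hdisjCF : ∀ Z ∈ k.inner, Z ∉ (C.comp F).path.map SpineLabel.sym ++ [x.sym] := by
    intro Z hZ
    have := hdisj Z hZ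
    simp only [TagCtx.path_comp, List.map_append, List.mem_append, List.mem_singleton]
    tauto
  have hkD : ∀ Z ∈ k.inner, Z ∉ spineLabels D v := by
    intro Z hZ
    have h1 := hdisj Z hZ
    -- The foot label of `D` is missing from its path, but it labels the node of adjunction, hence
    -- occurs on the path of `F` or as the foot `x`.
    have h2 : Z ≠ v.sym := by
      rintro rfl
      rw [huv] at h1
      cases F with
      | hole =>
        obtain rfl : x = u := by simpa [TagTree.rootLabel] using hu
        exact h1.2 rfl
      | node f l c r =>
        obtain rfl : f = u := by simpa [TagTree.rootLabel] using hu
        simp [TagCtx.path] at h1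
    simp only [spineLabels, List.mem_append, List.mem_singleton]
    tauto
  -- Decrease the records by dominance, remove `D` by its soundness, then remove the host by its
  -- own.
  have key : ∀ (C' F' : TagCtx (SpineLabel N) T) (k' : SpineLabel N),
      markSpine x.sym k.inner (C.comp F) = C'.comp F' → (F'.fill s).rootLabel = some k' →
      k'.sym = v.sym → (∀ Z ∈ k'.inner, Z ∉ spineLabels D v) →
      (markSpine x.sym k.inner (C.comp ((markSpine v.sym u.inner D).comp F))).Dominates
        (C'.comp ((markSpine v.sym k'.inner D).comp F')) → G.Generates (.tree s) w := by
    intro C' F' k' heq hk' hsym hdisj' hdom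
    have h1 := generates_fill (.refl s) (fun w hw => hw) hdom hw
    rw [TagCtx.fill_comp, TagCtx.fill_comp] at h1
    have h2 := generates_fill (rootDominates_markSpine v.sym (hsym ▸ hroot) hk')
      (hD (F'.fill s) k' hk' hsym hdisj') (.refl C') h1
    rw [← TagCtx.fill_comp, ← heq] at h2
    exact hCF s k hs hk hdisjCF w h2
  cases C with
  | hole =>
    cases F with
    | hole =>
      obtain rfl : x = u := by simpa [TagTree.rootLabel] using hu
      exact key .hole .hole k rfl hs (hk.trans huv.symm) hkD
        (markSpine_markSpine_comp_dominates Set.subset_union_right hne _)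
    | node f l c r =>
      obtain rfl : f = u := by simpa [TagTree.rootLabel] using hu
      -- At the root of the host the record grows by `k.inner` only; the root label of the host is
      -- not added.
      refine key .hole (markSpine x.sym k.inner (.node f l c r)) (enlarge k.inner f) rfl rfl
        huv.symm ?_ (markSpine_markSpine_comp_dominates subset_rfl hne _)
      rintro Z (hZ | hZ)
      · exact hin Z hZ
      · exact hkD Z hZ
  | node a l c r =>
    cases F with
    | hole =>
      obtain rfl : x = u := by simpa [TagTree.rootLabel] using hu
      refine key (markSpine x.sym k.inner (.node a l c r)) .hole k ?_ hs (hk.trans huv.symm) hkD ?_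
      · rw [TagCtx.comp_hole, TagCtx.comp_hole]
      · rw [markSpine_node_comp, TagCtx.comp_hole, TagCtx.comp_hole]
        exact .comp (.refl _) (mapPath_markSpine_dominates
          (Set.subset_union_right.trans (Set.subset_insert _ _)) D)
    | node f l' c' r' =>
      obtain rfl : f = u := by simpa [TagTree.rootLabel] using hu
      refine key (markSpine x.sym k.inner (.node a l c r))
        ((TagCtx.node f l' c' r').mapPath (enclose x.sym k.inner)) (enclose x.sym k.inner f)
        (markSpine_node_comp ..) rfl huv.symm ?_ ?_
      -- Strictly inside the spine the record also contains the root label of the host, so condition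
      -- (c) is needed.
      · have hx : x.sym ∉ spineLabels D v := by simpa using hhost
        rintro Z (rfl | hZ | hZ)
        · exact hx
        · exact hin Z hZ
        · exact hkD Z hZ
      · rw [markSpine_node_comp, TagCtx.mapPath_comp]
        exact .comp (.refl _) (.comp (mapPath_markSpine_dominates subset_rfl D) (.refl _))

/-- The marked path does not depend on the siblings `l` and `r`, so a subtree beside the spine can
be exchanged before or after marking. -/
theorem exists_markSpine_comp_node (X : N) (K : Set N) (E : TagCtx (SpineLabel N) T)
    (u : SpineLabel N) (c : TagCtx (SpineLabel N) T) :
    ∃ (E' : TagCtx (SpineLabel N) T) (u' : SpineLabel N) (c' : TagCtx (SpineLabel N) T),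
      ∀ l r, markSpine X K (E.comp (.node u l c r)) = E'.comp (.node u' l c' r) := by
  cases E with
  | hole => exact ⟨.hole, _, _, fun l r => rfl⟩
  | node v l₀ c₀ r₀ =>
    refine ⟨markSpine X K (.node v l₀ c₀ r₀), enclose X K u, c.mapPath (enclose X K),
      fun l r => ?_⟩
    rw [markSpine_node_comp]
    rfl

/-- The derived trees that are covered by top-down derivations. -/
inductive Covered (G : TreeAdjoiningGrammar N T) : TagTree (SpineLabel N) T → Prop
  | initial (γ : TagTree (SpineLabel N) T) (t : TagTree N T) (hclean : γ.Clean)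
      (hff : γ.FootFree) (ht : t ∈ G.initial)
      (hroot : γ.rootLabel.map SpineLabel.sym = t.rootLabel)
      (h : ∀ w, G.Generates (.tree γ) w → G.Generates (.tree (unmarked t)) w) : Covered G γ
  | auxiliary (D : TagCtx (SpineLabel N) T) (v : SpineLabel N) (hclean : D.Clean)
      (hff : D.FootFree)
      (hroot : (D.fill (.foot v)).rootLabel.map SpineLabel.sym = some v.sym)
      (h : G.AdjunctionSound D v.sym) : Covered G (D.fill (.foot v))

theorem Covered.clean {γ : TagTree (SpineLabel N) T} (h : G.Covered γ) : γ.Clean := by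
  cases h with
  | initial _ _ hclean => exact hclean
  | auxiliary D v hclean => exact (TagCtx.clean_fill ..).2 ⟨hclean, .foot v⟩

theorem rootLabel_fill_congr {s s' : TagTree (SpineLabel N) T}
    (h : s'.rootLabel.map SpineLabel.sym = s.rootLabel.map SpineLabel.sym)
    (C : TagCtx (SpineLabel N) T) :
    (C.fill s').rootLabel.map SpineLabel.sym = (C.fill s).rootLabel.map SpineLabel.sym := by
  cases C with
  | hole => exact h
  | node => rfl

/-- Handles all changes away from the spine of the host. If the host is auxiliary, the replaced
foot-free subtree hangs off the spine, and the spine labels entering its soundness condition stay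
the same. -/
theorem Covered.replace {C : TagCtx (SpineLabel N) T} {s s' : TagTree (SpineLabel N) T}
    (hC : G.Covered (C.fill s)) (hs : s.FootFree) (hs' : s'.FootFree) (hclean : s'.Clean)
    (hroot : s'.rootLabel.map SpineLabel.sym = s.rootLabel.map SpineLabel.sym)
    (hdom : RootDominates s' s)
    (h : ∀ w, G.Generates (.tree s') w → G.Generates (.tree s) w) : G.Covered (C.fill s') := by
  have hc : (C.fill s').Clean :=
    (TagCtx.clean_fill ..).2 ⟨((TagCtx.clean_fill ..).1 hC.clean).1, hclean⟩
  have hr := rootLabel_fill_congr hroot C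
  generalize hγ : C.fill s = γ at hC
  cases hC with
  | initial _ t hclean hff ht hroot' hL =>
    subst hγ
    rw [TagCtx.footFree_fill] at hff
    exact .initial _ t hc ((TagCtx.footFree_fill ..).2 ⟨hff.1, hs'⟩) ht (hr.trans hroot')
      fun w hw => hL w (generates_fill hdom h (.refl C) hw)
  | auxiliary D v hclean hff hroot' hL =>
    have hside : ∀ D' : TagCtx (SpineLabel N) T, C.fill s' = D'.fill (.foot v) → D'.FootFree →
        D'.path = D.path → (∀ X K r, ∃ C' : TagCtx (SpineLabel N) T,
          (markSpine X K D).fill r = C'.fill s ∧ (markSpine X K D').fill r = C'.fill s') →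
        G.Covered (C.fill s') := by
      intro D' hD' hff' hpath hmark
      rw [hγ, hroot'] at hr
      rw [hD'] at hc hr ⊢
      refine .auxiliary D' v ((TagCtx.clean_fill ..).1 hc).1 hff' hr ?_
      intro r u hru hu hdisj w hw
      rw [hpath] at hdisj
      obtain ⟨C', h1, h2⟩ := hmark v.sym u.inner r
      refine hL r u hru hu hdisj w ?_
      rw [h1]
      rw [h2] at hw
      exact generates_fill hdom h (.refl C') hw
    obtain ⟨F, rfl, rfl⟩ | ⟨E, u, l, B, m, c, r, rfl, rfl⟩ | ⟨E, u, l, B, m, c, r, rfl, rfl⟩ :=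
      TagCtx.fill_foot_eq_fill hγ.symm
    · simp at hs
    · refine hside (E.comp (.node u (l ++ B.fill s' :: m) c r)) (by simp) ?_ ?_ ?_
      · simp only [TagCtx.footFree_comp, TagCtx.FootFree, List.mem_append, List.mem_cons, or_imp,
          forall_and, forall_eq, TagCtx.footFree_fill] at hff ⊢
        tauto
      · simp [TagCtx.path]
      · intro X K r₀
        obtain ⟨E', u', c', hE⟩ := exists_markSpine_comp_node X K E u c
        exact ⟨E'.comp (.node u' l B (m ++ c'.fill r₀ :: r)), by simp [hE], by simp [hE]⟩
    · refine hside (E.comp (.node u l c (m ++ B.fill s' :: r))) (by simp) ?_ ?_ ?_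
      · simp only [TagCtx.footFree_comp, TagCtx.FootFree, List.mem_append, List.mem_cons, or_imp,
          forall_and, forall_eq, TagCtx.footFree_fill] at hff ⊢
        tauto
      · simp [TagCtx.path]
      · intro X K r₀
        obtain ⟨E', u', c', hE⟩ := exists_markSpine_comp_node X K E u c
        exact ⟨E'.comp (.node u' (l ++ c'.fill r₀ :: m) B r), by simp [hE], by simp [hE]⟩

theorem Covered.of_fill_foot {D : TagCtx (SpineLabel N) T} {v : SpineLabel N}
    (h : G.Covered (D.fill (.foot v))) :
    D.Clean ∧ D.FootFree ∧ (D.fill (.foot v)).rootLabel.map SpineLabel.sym = some v.sym ∧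
      G.AdjunctionSound D v.sym := by
  generalize hγ : D.fill (.foot v) = γ at h
  cases h with
  | initial _ _ _ hff =>
    subst hγ
    simp at hff
  | auxiliary D' v' hclean hff hroot h =>
    obtain ⟨rfl, rfl⟩ := hff.eq_of_fill_foot hγ.symm
    exact ⟨hclean, hff, hroot, h⟩

/-- An initial tree is traced back to the elementary tree it grew from, an auxiliary one to its
effect on an arbitrary tree; both invariants are needed at once because either kind may be inserted
into the other. -/
theorem RegularDerivable.covered {γ : TagTree (SpineLabel N) T} (h : G.RegularDerivable γ) :
    G.Covered γ := by
  induction h with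
  | initial t ht =>
    refine .initial _ t (TagTree.clean_map_fresh t) ((G.initial_footFree t ht).map fresh) ht ?_
      fun w hw => hw
    rw [unmarked_eq, TagTree.rootLabel_map]
    simp [Function.comp_def, fresh]
  | auxiliary t ht =>
    obtain ⟨X, D, hD, rfl, hroot⟩ := G.auxiliary_foot t ht
    have heq : unmarked (D.fill (.foot X)) =
        (D.map fresh : TagCtx (SpineLabel N) T).fill (.foot (fresh X)) := by
      rw [unmarked_eq, TagCtx.map_fill, TagTree.map]
    have hclean : (unmarked (D.fill (.foot X))).Clean := TagTree.clean_map_fresh _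
    have hroot' : (unmarked (D.fill (.foot X))).rootLabel.map SpineLabel.sym = some X := by
      rw [unmarked_eq, TagTree.rootLabel_map, hroot]
      rfl
    rw [heq] at hclean hroot' ⊢
    exact .auxiliary _ _ ((TagCtx.clean_fill ..).1 hclean).1 (hD.map fresh) hroot'
      (IsAux.adjunctionSound ⟨hD, ht, hroot⟩)
  | substitution C u v t hhost ht hinit hroot hsym ihhost iht =>
    -- The root record of `t` need not contain that of the replaced node; root dominance holds
    -- because cleanliness makes the latter empty.
    have hu : u.inner = ∅ := by
      have := ((TagCtx.clean_fill ..).1 ihhost.clean).2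
      cases this with
      | node _ _ hv => exact hv rfl
    refine ihhost.replace (by simp) hinit iht.clean (by rw [hroot]; exact congrArg some hsym) ?_ ?_
    · intro u' hu'
      obtain rfl : v = u' := by simpa [hroot] using hu'
      exact ⟨u, rfl, hsym, by simp [hu]⟩
    · intro w hw
      cases iht with
      | initial _ t₀ _ _ ht₀ hroot₀ hL =>
        refine .rewrite (.body _) (.rewrite (.substitute t₀ u ht₀ ?_) (hL w hw))
        rw [← hroot₀, hroot, ← hsym]
        rfl
      | auxiliary D v => simp at hinit
  | adjunction C D s u v hhost haux hlabel hsym hreg ihhost ihaux =>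
    obtain ⟨hclean, hff, hroot, hsound⟩ := ihaux.of_fill_foot
    have hcs := ((TagCtx.clean_fill ..).1 ihhost.clean)
    have hc' : ((markSpine v.sym u.inner D).fill s).Clean :=
      (TagCtx.clean_fill ..).2 ⟨(clean_markSpine ..).2 hclean, hcs.2⟩
    have hr' := rootLabel_markSpine v.sym u.inner (hsym ▸ hroot) hlabel
    -- A foot-free excised subtree means that the node is not on the spine of the host. Otherwise
    -- the host must be auxiliary, and the adjunction extends its spine.
    by_cases hs : s.FootFree
    · refine ihhost.replace hs ((TagCtx.footFree_fill ..).2 ⟨(footFree_markSpine ..).2 hff, hs⟩) hc'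
        hr' (rootDominates_markSpine _ (hsym ▸ hroot) hlabel)
        (hsound s u hlabel hsym.symm hreg.inside)
    · have hr := rootLabel_fill_congr hr' C
      generalize hγ : C.fill s = γ at ihhost
      cases ihhost with
      | initial _ t _ hff' =>
        subst hγ
        simp [hs] at hff'
      | auxiliary D₀ x hclean₀ hff₀ hroot₀ hsound₀ =>
        obtain ⟨F, rfl, rfl⟩ | ⟨E, a, l, B, m, c, r, rfl, rfl⟩ |
          ⟨E, a, l, B, m, c, r, rfl, rfl⟩ := TagCtx.fill_foot_eq_fill hγ.symm
        · have heq : C.fill ((markSpine v.sym u.inner D).fill (F.fill (.foot x))) =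
              (C.comp ((markSpine v.sym u.inner D).comp F)).fill (.foot x) := by simp
          rw [hγ, hroot₀] at hr
          rw [TagCtx.footFree_comp] at hff₀
          have hclean' := (TagCtx.clean_fill C _).2 ⟨hcs.1, hc'⟩
          rw [heq] at hr hclean' ⊢
          refine .auxiliary _ x ((TagCtx.clean_fill ..).1 hclean').1 ?_ hr
            (hsound₀.adjoin hsound hlabel hsym hroot ?_ hreg.inside)
          · simp only [TagCtx.footFree_comp, footFree_markSpine]
            exact ⟨hff₀.1, hff, hff₀.2⟩
          · have := hreg.host F x rfl
            tauto
        · simp [TagCtx.FootFree, or_imp, forall_and, hs] at hff₀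
        · simp [TagCtx.FootFree, or_imp, forall_and, hs] at hff₀

/-- A completed tree needs no further insertion: the grammar reads off its yield using `body` at
every node. -/
theorem generates_of_completed (γ : TagTree (SpineLabel N) T) (h : (erase γ).Completed) :
    G.Generates (.tree γ) (erase γ).yield := by
  refine .rewrite (.body γ) ?_
  induction γ using TagTree.induct with
  | leaf a =>
    rw [erase, TagTree.map, TagTree.yield]
    cases a with
    | none => exact .eps (.inl rfl)
    | some a => exact .term rfl
  | foot v =>
    rw [erase, TagTree.map] at h
    cases h
  | node v ts ih =>
    rw [erase, TagTree.map] at h ⊢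
    rw [TagTree.yield]
    obtain ⟨hne, h'⟩ : ts.map (TagTree.map SpineLabel.sym) ≠ [] ∧
        ∀ t ∈ ts.map (TagTree.map SpineLabel.sym), t.Completed := by
      cases h with
      | node _ _ hne h => exact ⟨hne, h⟩
    refine .rewrite (.children v ts (by simpa using hne)) ?_
    clear hne h
    induction ts with
    | nil => exact .eps (.inr rfl)
    | cons t ts ih' =>
      simp only [List.map_cons, List.flatten_cons]
      refine .bin ⟨t, ts, rfl, rfl, rfl⟩
        (Generates.rewrite (.body t) (ih t List.mem_cons_self ?_)) (ih' ?_ ?_)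
      · exact h' _ (by simp [erase])
      · exact fun t ht => ih t (List.mem_cons_of_mem _ ht)
      · exact fun t ht => h' t (List.mem_cons_of_mem _ ht)

/-- The item from which the strings of the language are derived. -/
def startItem (G : TreeAdjoiningGrammar N T) : TagItem N T := .body (.node (fresh G.start) [])

theorem generates_of_mem_regularTrees {t : TagTree N T} (h : t ∈ G.regularTrees) :
    G.Generates G.startItem t.yield := by
  obtain ⟨⟨γ, hγ, rfl⟩, hcompl, hroot⟩ := h
  have hw := generates_of_completed (G := G) γ hcompl
  cases hγ.covered with
  | initial _ t₀ _ _ ht₀ hroot₀ hL =>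
    refine .rewrite (.substitute t₀ _ ht₀ ?_) (hL _ hw)
    rw [← hroot₀, ← TagTree.rootLabel_map]
    exact hroot
  | auxiliary D v =>
    have := TagTree.FootFree.of_map _ hcompl.footFree
    simp at this

end TreeAdjoiningGrammar

/-! ### Top-down derivations yield regular trees. -/

namespace TreeAdjoiningGrammar

variable {N T : Type} {G : TreeAdjoiningGrammar N T}

/-- The derivable initial trees in which only the given part is not completed can be completed
with the given yield. -/
def Completable (G : TreeAdjoiningGrammar N T) : TagItem N T → List T → Prop
  | .tree s, w | .body s, w => ∀ C : TagCtx (SpineLabel N) T, G.RegularDerivable (C.fill s) →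
      (C.fill s).FootFree → ∃ s', G.RegularDerivable (C.fill s') ∧ (C.fill s').FootFree ∧
        (erase s').Completed ∧ (erase s').yield = w ∧
        s'.rootLabel.map SpineLabel.sym = s.rootLabel.map SpineLabel.sym
  | .forest ts, w => ∀ (C : TagCtx (SpineLabel N) T) (u : SpineLabel N)
      (l : List (TagTree (SpineLabel N) T)), G.RegularDerivable (C.fill (.node u (l ++ ts))) →
      (C.fill (.node u (l ++ ts))).FootFree →
      ∃ ts', G.RegularDerivable (C.fill (.node u (l ++ ts'))) ∧
        (C.fill (.node u (l ++ ts'))).FootFree ∧ ts'.length = ts.length ∧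
        (∀ t ∈ ts', (erase t).Completed) ∧ (ts'.map fun t => (erase t).yield).flatten = w

/-- The surrounding context is arbitrary so that siblings can be completed one after another within
the same derivable tree. -/
theorem Generates.completable {i : TagItem N T} {w : List T} (h : G.Generates i w) :
    G.Completable i w := by
  induction h with
  | eps h =>
    obtain rfl | rfl := h
    · intro C hC hff
      exact ⟨.leaf none, hC, hff, by rw [erase, TagTree.map]; exact .leaf _,
        by rw [erase, TagTree.map, TagTree.yield]; rfl, rfl⟩
    · intro C u l hC hff
      exact ⟨[], hC, hff, rfl, by simp, rfl⟩
  | @term i a h =>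
    cases h
    intro C hC hff
    exact ⟨.leaf (some a), hC, hff, by rw [erase, TagTree.map]; exact .leaf _,
        by rw [erase, TagTree.map, TagTree.yield]; rfl, rfl⟩
  | bin h _ _ ih₁ ih₂ =>
    obtain ⟨t, ts, rfl, rfl, rfl⟩ := h
    intro C u l hC hff
    -- The first tree is completed with the unfinished `ts` to its right; then `ts` is completed
    -- with `t'` among the left siblings.
    obtain ⟨t', ht', hff', hcompl, hyield, -⟩ := ih₁ (C.comp (.node u l .hole ts))
      (by simpa using hC) (by simpa using hff)
    obtain ⟨ts', hts', hff'', hlen, hcompl', hyield'⟩ := ih₂ C u (l ++ [t'])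
      (by simpa using ht') (by simpa using hff')
    refine ⟨t' :: ts', by simpa using hts', by simpa using hff'', by simp [hlen], ?_, ?_⟩
    · simpa [hcompl] using hcompl'
    · simp [hyield, hyield']
  | unit h hr ih =>
    cases h with
    | body s => exact ih
    | @adjoin D X s u hD hne hs hu hin =>
      intro C hC hff
      have heq : unmarked (D.fill (.foot X)) =
          (D.map fresh : TagCtx (SpineLabel N) T).fill (.foot (fresh X)) := by
        rw [unmarked_eq, TagCtx.map_fill, TagTree.map]
      have hsff := (TagCtx.footFree_fill ..).1 hff
      have hroot : ((D.map fresh : TagCtx (SpineLabel N) T).fill (.foot (fresh X))).rootLabel.map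
          SpineLabel.sym = some u.sym := by
        rw [← heq, unmarked_eq, TagTree.rootLabel_map, hD.root, hu]
        rfl
      -- The host contains no foot, so its condition is vacuous; the grammar rule itself supplies
      -- the condition on records.
      have hreg : RegularAt C s u (D.map fresh) (fresh X) :=
        ⟨fun F x hF => absurd hsff.2 (by simp [hF]), hin⟩
      have hder := RegularDerivable.adjunction C (D.map fresh) s u (fresh X) hC
        (heq ▸ .auxiliary _ hD.mem) hs hu.symm hreg
      obtain ⟨s', h1, h2, h3, h4, h5⟩ := ih C hder (by
        rw [TagCtx.footFree_fill, TagCtx.footFree_fill, footFree_markSpine]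
        exact ⟨hsff.1, hD.footFree.map fresh, hsff.2⟩)
      exact ⟨s', h1, h2, h3, h4, h5.trans (rootLabel_markSpine X u.inner hroot hs)⟩
    | children u ts hne =>
      intro C hC hff
      obtain ⟨ts', h1, h2, h3, h4, h5⟩ := ih C u [] hC hff
      refine ⟨.node u ts', h1, h2, ?_, ?_, rfl⟩
      · rw [erase, TagTree.map]
        refine .node _ _ ?_ fun t ht => ?_
        · rintro h
          rw [List.map_eq_nil_iff] at h
          subst h
          exact hne (List.length_eq_zero_iff.1 h3.symm)
        · obtain ⟨t', ht', rfl⟩ := List.mem_map.1 ht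
          exact h4 t' ht'
      · rw [erase, TagTree.map, TagTree.yield, ← h5, List.map_map]
        rfl
    | substitute t u ht hroot =>
      intro C hC hff
      have hff' : (unmarked t : TagTree (SpineLabel N) T).FootFree :=
        (G.initial_footFree t ht).map fresh
      have hroot' : (unmarked t : TagTree (SpineLabel N) T).rootLabel = some (fresh u.sym) := by
        rw [unmarked_eq, TagTree.rootLabel_map, hroot]
        rfl
      obtain ⟨s', h1, h2, h3, h4, h5⟩ := ih C
        (.substitution C u (fresh u.sym) _ hC (.initial t ht) hff' hroot' rfl)
        ((TagCtx.footFree_fill ..).2 ⟨((TagCtx.footFree_fill ..).1 hff).1, hff'⟩)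
      exact ⟨s', h1, h2, h3, h4, by rw [h5, hroot']; rfl⟩

theorem exists_mem_regularTrees {w : List T} (h : G.Generates G.startItem w) :
    ∃ t ∈ G.regularTrees, t.yield = w := by
  obtain ⟨t, ht, hroot, h⟩ : ∃ t ∈ G.initial, t.rootLabel = some G.start ∧
      G.Generates (.tree (unmarked t)) w := by
    generalize hi : G.startItem = i at h
    cases h with
    | eps h => rcases h with rfl | rfl <;> simp [startItem] at hi
    | term h =>
      cases h
      simp [startItem] at hi
    | bin h =>
      obtain ⟨t, ts, rfl, -⟩ := h
      simp [startItem] at hi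
    | unit h hr =>
      subst hi
      cases h with
      | children _ _ hne => exact absurd rfl hne
      | substitute t _ ht hroot => exact ⟨t, ht, hroot, hr⟩
  obtain ⟨s, h1, -, h3, h4, h5⟩ := h.completable .hole (.initial t ht)
    ((G.initial_footFree t ht).map fresh)
  refine ⟨erase s, ⟨⟨s, h1, rfl⟩, h3, ?_⟩, h4⟩
  rw [erase, TagTree.rootLabel_map, h5, ← TagTree.rootLabel_map, ← hroot, unmarked_eq]
  rw [TagTree.rootLabel_map, TagTree.rootLabel_map]
  simp [Function.comp_def, fresh]

theorem generates_startItem_iff {w : List T} :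
    G.Generates G.startItem w ↔ ∃ t ∈ G.regularTrees, t.yield = w :=
  ⟨exists_mem_regularTrees, fun ⟨_, ht, hw⟩ => hw ▸ generates_of_mem_regularTrees ht⟩

end TreeAdjoiningGrammar

/-! ### Finitely many items suffice. -/

namespace TagTree

variable {V W N T : Type}

/-- The tree has height at most `n`, and its nodes have at most `b` children. -/
inductive HeightLE (b : ℕ) : ℕ → TagTree V T → Prop
  | leaf (n : ℕ) (a : Option T) : HeightLE b n (leaf a)
  | foot (n : ℕ) (v : V) : HeightLE b n (foot v)
  | node (n : ℕ) (v : V) (ts : List (TagTree V T)) (hb : ts.length ≤ b)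
      (h : ∀ t ∈ ts, HeightLE b n t) : HeightLE b (n + 1) (node v ts)

theorem HeightLE.mono {b n : ℕ} {t : TagTree V T} (h : HeightLE b n t) :
    ∀ {b' n' : ℕ}, b ≤ b' → n ≤ n' → HeightLE b' n' t := by
  induction h with
  | leaf n a => exact fun _ _ => .leaf _ a
  | foot n v => exact fun _ _ => .foot _ v
  | node n v ts hlen _ ih =>
    intro b' n' hb hn
    obtain _ | n' := n'
    · omega
    · exact .node n' v ts (hlen.trans hb) fun t ht => ih t ht hb (by omega)

theorem HeightLE.map {b n : ℕ} {t : TagTree V T} (h : HeightLE b n t) (f : V → W) :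
    HeightLE b n (t.map f) := by
  induction h with
  | leaf n a => rw [TagTree.map]; exact .leaf _ a
  | foot n v => rw [TagTree.map]; exact .foot _ _
  | node n v ts hlen _ ih =>
    rw [TagTree.map]
    refine .node n _ _ (by simpa using hlen) fun t ht => ?_
    obtain ⟨t', ht', rfl⟩ := List.mem_map.1 ht
    exact ih t' ht'

theorem exists_heightLE (t : TagTree V T) : ∃ n, HeightLE n n t := by
  induction t using induct with
  | leaf a => exact ⟨0, .leaf 0 a⟩
  | foot v => exact ⟨0, .foot 0 v⟩
  | node v ts ih =>
    obtain ⟨n, hn⟩ : ∃ n, ∀ t ∈ ts, HeightLE n n t := by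
      induction ts with
      | nil => exact ⟨0, by simp⟩
      | cons t ts ih' =>
        obtain ⟨m, hm⟩ := ih t List.mem_cons_self
        obtain ⟨n, hn⟩ := ih' fun t ht => ih t (List.mem_cons_of_mem _ ht)
        refine ⟨max m n, fun s hs => ?_⟩
        obtain rfl | hs := List.mem_cons.1 hs
        · exact hm.mono (le_max_left _ _) (le_max_left _ _)
        · exact (hn s hs).mono (le_max_right _ _) (le_max_right _ _)
    exact ⟨max (n + 1) ts.length, (HeightLE.node n v ts (le_max_right (n + 1) _) fun t ht =>
      (hn t ht).mono (by omega) le_rfl).mono le_rfl (le_max_left _ _)⟩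

theorem finite_lists {α : Type} {s : Set α} (hs : s.Finite) (b : ℕ) :
    {l : List α | l.length ≤ b ∧ ∀ x ∈ l, x ∈ s}.Finite := by
  have := hs.to_subtype
  refine ((List.finite_length_le s b).image (List.map Subtype.val)).subset ?_
  rintro l ⟨hl, hls⟩
  exact ⟨l.attachWith _ hls, by simpa using hl, by simp⟩

theorem finite_heightLE [Finite V] [Finite T] (b n : ℕ) :
    {t : TagTree V T | HeightLE b n t}.Finite := by
  have hbase : (Set.range (leaf : Option T → TagTree V T) ∪ Set.range foot).Finite :=
    (Set.finite_range _).union (Set.finite_range _)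
  induction n with
  | zero =>
    refine hbase.subset ?_
    rintro t ht
    cases ht with
    | leaf _ a => exact .inl ⟨a, rfl⟩
    | foot _ v => exact .inr ⟨v, rfl⟩
  | succ n ih =>
    refine (hbase.union ((Set.finite_univ.prod (finite_lists ih b)).image
      fun p : V × List (TagTree V T) => node p.1 p.2)).subset ?_
    rintro t ht
    cases ht with
    | leaf _ a => exact .inl (.inl ⟨a, rfl⟩)
    | foot _ v => exact .inl (.inr ⟨v, rfl⟩)
    | node _ v ts hb h => exact .inr ⟨(v, ts), ⟨trivial, hb, h⟩, rfl⟩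

/-- The height of every subtree is bounded in terms of the size of the record at its root. -/
inductive Bounded (b d : ℕ) : TagTree (SpineLabel N) T → Prop
  | leaf (a : Option T) : Bounded b d (leaf a)
  | foot (v : SpineLabel N) : Bounded b d (foot v)
  | node (v : SpineLabel N) (ts : List (TagTree (SpineLabel N) T))
      (hv : HeightLE b (d * (1 + v.inner.ncard)) (node v ts)) (h : ∀ t ∈ ts, Bounded b d t) :
      Bounded b d (node v ts)

theorem HeightLE.bounded {b n d : ℕ} {t : TagTree (SpineLabel N) T} (h : HeightLE b n t)
    (hn : n ≤ d) : Bounded b d t := by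
  induction h with
  | leaf n a => exact .leaf a
  | foot n v => exact .foot v
  | node n v ts hb h ih =>
    refine .node v ts ((HeightLE.node n v ts hb h).mono le_rfl ?_) fun t ht => ih t ht (by omega)
    nlinarith [Nat.zero_le (d * v.inner.ncard)]

theorem Bounded.heightLE {b d : ℕ} {t : TagTree (SpineLabel N) T} (h : Bounded b d t)
    {u : SpineLabel N} (hu : t.rootLabel = some u) :
    HeightLE b (d * (1 + u.inner.ncard)) t := by
  cases h with
  | leaf a => simp [rootLabel] at hu
  | foot v => exact .foot _ v
  | node v ts hv _ =>
    obtain rfl : v = u := by simpa [rootLabel] using hu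
    exact hv

theorem Bounded.heightLE_card [Finite N] {b d : ℕ} {t : TagTree (SpineLabel N) T}
    (h : Bounded b d t) : HeightLE b (d * (1 + Nat.card N)) t := by
  cases h with
  | leaf a => exact .leaf _ a
  | foot v => exact .foot _ v
  | node v ts hv _ =>
    exact hv.mono le_rfl (Nat.mul_le_mul_left _ (Nat.add_le_add_left (Set.ncard_le_card _) _))

end TagTree

namespace TagCtx

open TagTree (HeightLE Bounded)

variable {N T : Type}

theorem heightLE_node_fill {b m n : ℕ} {v : SpineLabel N}
    {l r : List (TagTree (SpineLabel N) T)} {c : TagCtx (SpineLabel N) T}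
    {t s : TagTree (SpineLabel N) T} {f : SpineLabel N → SpineLabel N}
    (h : HeightLE b m ((node v l c r).fill t)) (hs : HeightLE b n s) (w : SpineLabel N) :
    HeightLE b (m + n) ((node w l (c.mapPath f) r).fill s) := by
  induction c generalizing m v w l r with
  | hole =>
    rw [node_fill] at h
    cases h with
    | node m _ _ hb h =>
      rw [Nat.add_right_comm]
      refine .node _ _ _ (by simpa using hb) fun t' ht' => ?_
      simp only [List.mem_append, List.mem_cons, mapPath, hole_fill] at ht'
      obtain ht' | rfl | ht' := ht'
      · exact (h t' (by simp [ht'])).mono le_rfl (by omega)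
      · exact hs.mono le_rfl (by omega)
      · exact (h t' (by simp [ht'])).mono le_rfl (by omega)
  | node v' l' c r' ih =>
    rw [node_fill] at h
    cases h with
    | node m _ _ hb h =>
      rw [Nat.add_right_comm]
      refine .node _ _ _ (by simpa using hb) fun t' ht' => ?_
      simp only [List.mem_append, List.mem_cons] at ht'
      obtain ht' | rfl | ht' := ht'
      · exact (h t' (by simp [ht'])).mono le_rfl (by omega)
      · exact ih (h _ (List.mem_append_right _ List.mem_cons_self)) (f v')
      · exact (h t' (by simp [ht'])).mono le_rfl (by omega)

/-- A new interior spine node adds at most `d` to the height bound of `s`. Its record strictly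
contains that of `s`, because `X` is new, so its permitted height exceeds that of `s` by at least
`d`. -/
theorem bounded_fill_enclose [Finite N] {b d m : ℕ} {c : TagCtx (SpineLabel N) T}
    {t s : TagTree (SpineLabel N) T} {u : SpineLabel N}
    (h : HeightLE b m (c.fill t)) (hm : m ≤ d) (hs : Bounded b d s)
    (hsu : s.rootLabel = some u) {X : N} (hX : X ∉ u.inner) :
    Bounded b d ((c.mapPath (enclose X u.inner)).fill s) := by
  induction c generalizing m with
  | hole => exact hs
  | node v l c r ih =>
    have hh := heightLE_node_fill (f := enclose X u.inner) h (hs.heightLE hsu) (enclose X u.inner v)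
    have hcard : 1 + u.inner.ncard ≤ (enclose X u.inner v).inner.ncard := by
      rw [add_comm, ← Set.ncard_insert_of_notMem hX (Set.toFinite _)]
      exact Set.ncard_le_ncard (Set.insert_subset_insert Set.subset_union_right) (Set.toFinite _)
    refine .node _ _ (hh.mono le_rfl ?_) fun t' ht' => ?_
    · have := Nat.mul_le_mul_left d hcard
      exact (Nat.add_le_add hm this).trans_eq (by ring)
    · rw [node_fill] at h
      cases h with
      | node m _ _ hb h =>
        simp only [List.mem_append, List.mem_cons] at ht'
        obtain ht' | rfl | ht' := ht'
        · exact (h t' (by simp [ht'])).bounded (by omega)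
        · exact ih (h _ (List.mem_append_right _ List.mem_cons_self)) (by omega)
        · exact (h t' (by simp [ht'])).bounded (by omega)

end TagCtx

namespace TreeAdjoiningGrammar

open TagTree (HeightLE Bounded)

variable {N T : Type} {G : TreeAdjoiningGrammar N T}

theorem exists_heightLE (G : TreeAdjoiningGrammar N T) :
    ∃ n, ∀ t, t ∈ G.initial ∨ t ∈ G.auxiliary → HeightLE n n t := by
  classical
  choose f hf using fun t : TagTree N T => t.exists_heightLE
  refine ⟨(G.initial ∪ G.auxiliary).sup f, fun t ht => ?_⟩
  have := Finset.le_sup (f := f) (Finset.mem_union.2 ht)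
  exact (hf t).mono this this

instance finite_spineLabel [Finite N] : Finite (SpineLabel N) :=
  Finite.of_injective (fun v : SpineLabel N => (v.sym, v.inner)) fun v w h => by
    cases v; cases w; simpa using h

/-- A finite set of items that contains all the items which are needed. -/
def boundedItems (N T : Type) (b d m : ℕ) : Set (TagItem N T) :=
  {i | match i with
    | .tree s => Bounded b d s
    | .body s => HeightLE b m s ∧ ∀ u ts, s = .node u ts → ∀ t ∈ ts, Bounded b d t
    | .forest ts => ts.length ≤ b ∧ ∀ t ∈ ts, Bounded b d t}

theorem finite_boundedItems [Finite N] [Finite T] (b d m : ℕ) :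
    (boundedItems N T b d m).Finite := by
  have h : {s : TagTree (SpineLabel N) T | Bounded b d s}.Finite :=
    (TagTree.finite_heightLE b (d * (1 + Nat.card N))).subset fun s hs => hs.heightLE_card
  refine (((h.image .tree).union ((TagTree.finite_heightLE b m).image .body)).union
    ((TagTree.finite_lists h b).image .forest)).subset ?_
  rintro (s | s | ts) hi
  · exact .inl (.inl ⟨s, hi, rfl⟩)
  · exact .inl (.inr ⟨s, hi.1, rfl⟩)
  · exact .inr ⟨ts, hi, rfl⟩

/-- The closed root of a freshly adjoined tree may exceed the bound for its record, since that
record need not have grown; hence `body` items have a separate height bound and only their children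
must be `Bounded`. -/
theorem isClosed_boundedItems [Finite N] {n : ℕ}
    (hG : ∀ t, t ∈ G.initial ∨ t ∈ G.auxiliary → HeightLE n n t) :
    G.regularGrammar.IsClosed (boundedItems N T n n (n + n * (1 + Nat.card N))) where
  bin := by
    rintro _ hi _ _ ⟨t, ts, rfl, rfl, rfl⟩
    obtain ⟨hlen, h⟩ := hi
    refine ⟨h t List.mem_cons_self, ?_, fun t ht => h t (List.mem_cons_of_mem _ ht)⟩
    rw [List.length_cons] at hlen
    omega
  unit := by
    intro i hi j hij
    cases hij with
    | body s =>
      have hs : Bounded n n s := hi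
      refine ⟨hs.heightLE_card.mono le_rfl (by omega), ?_⟩
      rintro u ts rfl
      cases hs with
      | node _ _ _ h => exact h
    | @adjoin D X s u hD hne hs hu hin =>
      have hbs : Bounded n n s := hi
      have hD' : HeightLE n n ((D.map fresh : TagCtx (SpineLabel N) T).fill (.foot (fresh X))) := by
        have := (hG _ (.inr hD.mem)).map (fresh : N → SpineLabel N)
        rwa [TagCtx.map_fill, TagTree.map] at this
      -- The foot of the adjoined tree puts `X` on its own spine; this forces records to grow and
      -- makes the process finite.
      have hX : X ∉ u.inner := fun h => hin X h (by simp [spineLabels, fresh])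
      cases D with
      | hole => exact absurd rfl hne
      | node v l c r =>
        rw [TagCtx.map, markSpine_node]
        rw [TagCtx.map] at hD'
        refine ⟨TagCtx.heightLE_node_fill hD' hbs.heightLE_card _, ?_⟩
        intro w ts hw t ht
        rw [TagCtx.node_fill, TagTree.node.injEq] at hw
        obtain ⟨-, rfl⟩ := hw
        rw [TagCtx.node_fill] at hD'
        cases hD' with
        | node m _ _ _ h =>
          simp only [List.mem_append, List.mem_cons] at ht
          obtain ht | rfl | ht := ht
          · exact (h t (List.mem_append_left _ ht)).bounded (by omega)
          · exact TagCtx.bounded_fill_enclose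
              (h _ (List.mem_append_right _ List.mem_cons_self)) (by omega) hbs hs hX
          · exact (h t (List.mem_append_right _ (List.mem_cons_of_mem _ ht))).bounded (by omega)
    | children u ts hne =>
      obtain ⟨h1, h2⟩ := hi
      refine ⟨?_, h2 u ts rfl⟩
      generalize n + n * (1 + Nat.card N) = m at h1
      cases h1 with
      | node _ _ _ hb _ => exact hb
    | substitute t u ht hroot => exact ((hG t (.inl ht)).map _).bounded le_rfl

theorem startItem_mem_boundedItems (b d m : ℕ) : G.startItem ∈ boundedItems N T b d (m + 1) := by
  refine ⟨.node _ _ _ (Nat.zero_le _) (by simp), ?_⟩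
  intro u ts h
  simp only [TagTree.node.injEq] at h
  simp [← h.2]

theorem recognizableInCubicTime_regularTrees [Finite N] [Finite T] (G : TreeAdjoiningGrammar N T) :
    RecognizableInCubicTime ({w | ∃ t ∈ G.regularTrees, t.yield = w} : Language T) := by
  obtain ⟨n, hn⟩ := G.exists_heightLE
  -- Passing to `n + 1` makes the height bound for `body` items positive, as the one-node start item
  -- requires.
  have hn' : ∀ t, t ∈ G.initial ∨ t ∈ G.auxiliary → HeightLE (n + 1) (n + 1) t :=
    fun t ht => (hn t ht).mono (Nat.le_succ n) (Nat.le_succ n)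
  have h := (isClosed_boundedItems hn').recognizableInCubicTime (finite_boundedItems _ _ _)
    (q := G.startItem) (by
      rw [Nat.add_right_comm]
      exact startItem_mem_boundedItems _ _ _)
  simpa only [generates_startItem_iff] using h

end TreeAdjoiningGrammar

theorem mainTheorem6 {N T : Type} [Finite N] [Finite T] (G : TreeAdjoiningGrammar N T)
    (hG : G.completedTrees = G.regularTrees) : RecognizableInCubicTime G.language := by
  have h := G.recognizableInCubicTime_regularTrees
  rw [← hG] at h
  exact h
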